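/- Let $m\ge 1$ and $N\ge 1$ be coprime integers, $G=\mathrm{SL}(m,\mathbb R)$, $\mathfrak g=\mathfrak{sl}(m,\mathbb R)$, and let $H\subset G$ be the stabilizer of the line $\mathbb R\mathbf e_1$. All sequences are $N$-periodic in $n$, $\mathbf a=(a_n^r)$ with $n\in\mathbb Z/N$, $1\le r\le m-1$. The group $H^N$ acts on $G^N$ by gauge transformations $(h\cdot g)_n=h_{n+1}g_nh_n^{-1}$. The moduli space of arc-length parametrized twisted $N$-gons in centro-affine $\mathbb R^m$ is coordinatized by the geometric invariants $\mathbf a\in\mathbb R^{N(m-1)}$, defined by $\gamma_{n+m}=a_n^{m-1}\gamma_{n+m-1}+\dots+a_n^1\gamma_{n+1}+(-1)^{m-1}\gamma_n$; it is identified with the part of $G^N/H^N$ formed by the orbits that meet the section $$\mathbf a\mapsto L(\mathbf a)=\{L_n\},\qquad L_n=\begin{pmatrix}(-1)^m\mathbf a_n& I_{m-1}\\(-1)^{m-1}&0\end{pmatrix}.$$ For $\mathcal F:G^N\to\mathbb R$ let $\nabla\mathcal F(L),\nabla'\mathcal F(L)\in\mathfrak g^N$ be the left and right gradients: $\frac{d}{d\epsilon}\big|_{0}\mathcal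 F(\exp(\epsilon\xi)L)=\sum_n\mathrm{tr}(\nabla_n\mathcal F\,\xi_n)$ and $\frac{d}{d\epsilon}\big|_{0}\mathcal F(L\exp(\epsilon\xi))=\sum_n\mathrm{tr}(\nabla'_n\mathcal F\,\xi_n)$ for all $\xi\in\mathfrak g^N$. Let $\xi_\pm$ be the strictly upper/lower triangular parts of $\xi\in\mathfrak g$, let $\xi_1$ (resp. $\xi_{-1}$) be its first row (resp. first column) without the $(1,1)$ entry, and put $r(\xi\wedge\eta)=\tfrac12\mathrm{tr}(\xi(\eta_+-\eta_-))$, $r(\xi\otimes\eta)=\mathrm{tr}(\xi_-\eta_+)$. The twisted Semenov-Tian-Shansky bracket and the companion tensor on $G^N$ are $$\{\mathcal F,\mathcal H\}=\sum_{n}\Big(r(\nabla_n\mathcal F\wedge\nabla_n\mathcal H)+r(\nabla'_n\mathcal F\wedge\nabla'_n\mathcal H)-r(\nabla'_{n+1}\mathcal F\otimes\nabla_n\mathcal H)+r(\nabla'_{n+1}\mathcal H\otimes\nabla_n\mathcal F)\Big),$$ $$\theta(\mathcal F,\mathcal H)=\tfrac12\sum_n\Big(\mathrm{tr}\big((\nabla'_n\mathcal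 F)_{-1}(\nabla'_n\mathcal H)_1\big)-\mathrm{tr}\big((\nabla'_n\mathcal H)_{-1}(\nabla'_n\mathcal F)_1\big)\Big).$$ The union of the gauge orbits of the points $L(\mathbf a)$ is open in $G^N$, and every smooth function $f$ of $\mathbf a$ has a unique gauge-invariant extension $\mathcal F$ to it, with $\mathcal F(L(\mathbf a))=f(\mathbf a)$, and $\mathcal F$ is smooth. For smooth $f,g$ with invariant extensions $\mathcal F,\mathcal G$ define the reduced brackets $$\{f,g\}_R(\mathbf a)=\{\mathcal F,\mathcal G\}(L(\mathbf a)),\qquad \{f,g\}_0(\mathbf a)=\theta(\mathcal F,\mathcal G)(L(\mathbf a)).$$ Then $\{f,g\}=\{f,g\}_R+\{f,g\}_0$ is a Poisson bracket on the smooth functions on the moduli space (it is bilinear and skew-symmetric, takes smooth functions to smooth functions, and satisfies the Leibniz rule and the Jacobi identity). Therefore the reduced Poisson brackets $\{\cdot,\cdot\}_R$ and $\{\cdot,\cdot\}_0$ are compatible: both are Poisson brackets and so is every linear combination $s\{\cdot,\cdot\}_R+t\{\cdot,\cdot\}_0$ with $s,t\in\mathbb R$, so they form a bi-Hamiltonian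 structure in every dimension $m$. -/

import Mathlib

open scoped BigOperators ContDiff Topology

noncomputable section

namespace TwistedPolygon

/-! Throughout, `m = d + 1` is the dimension of the centro-affine space `ℝ^m` and `N` the period.
Periodic sequences of period `N` are indexed by `ZMod N`, so that `n ↦ n + 1` is the shift. -/

/-! ### The exponential map `sl(m, ℝ) → SL(m, ℝ)` -/

section Exponential

open scoped Matrix.Norms.Operator

theorem differentiable_det (k : ℕ) :
    Differentiable ℝ (fun M : Matrix (Fin k) (Fin k) ℝ => M.det) := by
  have hentry : ∀ i j : Fin k, Differentiable ℝ (fun M : Matrix (Fin k) (Fin k) ℝ => M i j) :=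
    fun i j => (LinearMap.toContinuousLinearMap
      (Matrix.entryLinearMap ℝ ℝ i j : Matrix (Fin k) (Fin k) ℝ →ₗ[ℝ] ℝ)).differentiable
  simp only [Matrix.det_apply]
  refine Differentiable.fun_sum fun σ _ => Differentiable.const_smul ?_ _
  intro M
  exact (HasFDerivAt.finsetProd (u := Finset.univ)
    (g := fun i (M : Matrix (Fin k) (Fin k) ℝ) => M (σ i) i)
    fun i _ => (hentry (σ i) i M).hasFDerivAt).differentiableAt

theorem fderiv_det_one (k : ℕ) (A : Matrix (Fin k) (Fin k) ℝ) :
    fderiv ℝ (fun M : Matrix (Fin k) (Fin k) ℝ => M.det) 1 A = A.trace := by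
  have h1 : HasDerivAt (fun r : ℝ => (1 : Matrix (Fin k) (Fin k) ℝ) + r • A) A 0 := by
    have h := ((hasDerivAt_id (0 : ℝ)).smul_const A).const_add (1 : Matrix (Fin k) (Fin k) ℝ)
    rw [one_smul] at h
    exact h
  have h0 : (1 : Matrix (Fin k) (Fin k) ℝ) + (0 : ℝ) • A = 1 := by simp
  have h2 := (h0.symm ▸ (differentiable_det k 1).hasFDerivAt :
    HasFDerivAt (fun M : Matrix (Fin k) (Fin k) ℝ => M.det)
      (fderiv ℝ (fun M : Matrix (Fin k) (Fin k) ℝ => M.det) 1)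
      ((1 : Matrix (Fin k) (Fin k) ℝ) + (0 : ℝ) • A)).comp_hasDerivAt (0 : ℝ) h1
  obtain ⟨q, hq⟩ : ∃ q : Polynomial ℝ, ∀ r : ℝ,
      (1 + r • A).det = 1 + A.trace * r + q.eval r * r ^ 2 :=
    ⟨_, fun r => Matrix.det_one_add_smul r A⟩
  have h3 : HasDerivAt (fun r : ℝ => 1 + A.trace * r + q.eval r * r ^ 2) A.trace 0 := by
    have := (((hasDerivAt_id (0 : ℝ)).const_mul A.trace).const_add 1).add
      ((q.hasDerivAt 0).mul (hasDerivAt_pow 2 (0 : ℝ)))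
    exact this.congr_deriv (by simp)
  refine h2.unique ?_
  exact h3.congr_of_eventuallyEq (Filter.Eventually.of_forall hq)

theorem det_exp_of_trace_eq_zero (k : ℕ) (A : Matrix (Fin k) (Fin k) ℝ) (hA : A.trace = 0) :
    (NormedSpace.exp A).det = 1 := by
  have hder : ∀ t : ℝ, HasDerivAt (fun u : ℝ => (NormedSpace.exp (u • A)).det) 0 t := by
    intro t
    have hs : HasDerivAt (fun u : ℝ => NormedSpace.exp ((u - t) • A)) A t := by
      have h := hasDerivAt_exp_smul_const (𝕂 := ℝ) A (t - t)
      have h' := HasDerivAt.scomp (h := fun u : ℝ => u - t) t h ((hasDerivAt_id t).sub_const t)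
      exact h'.congr_deriv (by simp)
    have he : NormedSpace.exp ((t - t) • A) = (1 : Matrix (Fin k) (Fin k) ℝ) := by simp
    have h2 := (he.symm ▸ (differentiable_det k 1).hasFDerivAt :
      HasFDerivAt (fun M : Matrix (Fin k) (Fin k) ℝ => M.det)
        (fderiv ℝ (fun M : Matrix (Fin k) (Fin k) ℝ => M.det) 1)
        (NormedSpace.exp ((t - t) • A))).comp_hasDerivAt t hs
    have h3 := (h2.congr_deriv ((fderiv_det_one k A).trans hA)).const_mul (NormedSpace.exp (t • A)).det
    rw [mul_zero] at h3
    refine h3.congr_of_eventuallyEq (Filter.Eventually.of_forall fun u => ?_)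
    have hc : Commute (t • A) ((u - t) • A) :=
      ((Commute.refl A).smul_left t).smul_right (u - t)
    have hsum : u • A = t • A + (u - t) • A := by rw [← add_smul]; congr 1; ring
    simp only [Function.comp_apply]
    rw [hsum, Matrix.exp_add_of_commute _ _ hc, Matrix.det_mul]
  have hconst := is_const_of_deriv_eq_zero (fun t => (hder t).differentiableAt)
    (fun t => (hder t).deriv) 1 0
  simpa using hconst

end Exponential

/-- The Lie algebra `sl(m, ℝ)`, `m = d + 1`. -/
abbrev Alg (d : ℕ) : Type := LieAlgebra.SpecialLinear.sl (Fin (d + 1)) ℝ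

/-- The group `G = SL(m, ℝ)`, `m = d + 1`. -/
abbrev Grp (d : ℕ) : Type := Matrix.SpecialLinearGroup (Fin (d + 1)) ℝ

/-- The exponential map `sl(m, ℝ) → SL(m, ℝ)`. -/
def expSL {d : ℕ} (ξ : Alg d) : Grp d :=
  ⟨NormedSpace.exp (ξ : Matrix (Fin (d + 1)) (Fin (d + 1)) ℝ),
    det_exp_of_trace_eq_zero (d + 1) _ (LinearMap.mem_ker.1 ξ.2)⟩

/-! ### Smooth functions on `G^N` and their gradients -/

/-- The matrix entries of an element of `G^N`. -/
def entries {d N : ℕ} (L : ZMod N → Grp d) : ZMod N → Fin (d + 1) → Fin (d + 1) → ℝ :=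
  fun n i j => (L n : Matrix (Fin (d + 1)) (Fin (d + 1)) ℝ) i j

/-- `F : G^N → ℝ` is smooth at `L`: near `L` it is the restriction to the embedded submanifold
`G^N` of a smooth function of the matrix entries. -/
def SmoothAt {d N : ℕ} [NeZero N] (F : (ZMod N → Grp d) → ℝ) (L : ZMod N → Grp d) : Prop :=
  ∃ Φ : (ZMod N → Fin (d + 1) → Fin (d + 1) → ℝ) → ℝ,
    ContDiffAt ℝ ∞ Φ (entries L) ∧ ∀ᶠ L' in 𝓝 L, F L' = Φ (entries L')

/-- The inner product `⟨ξ, η⟩ = ∑ₙ tr (ξₙ ηₙ)` on `sl(m, ℝ)^N`. -/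
def pairing {d N : ℕ} [NeZero N] (ξ η : ZMod N → Alg d) : ℝ :=
  ∑ n, ((ξ n : Matrix (Fin (d + 1)) (Fin (d + 1)) ℝ) * (η n).1).trace

/-- `X` is the left gradient of `F` at `L`:
`d/dε F (exp (ε ξ) L) = ⟨X, ξ⟩` at `ε = 0`, for all `ξ`. -/
def IsLeftGradient {d N : ℕ} [NeZero N] (F : (ZMod N → Grp d) → ℝ) (L : ZMod N → Grp d)
    (X : ZMod N → Alg d) : Prop :=
  ∀ ξ : ZMod N → Alg d,
    HasDerivAt (fun ε : ℝ => F (fun n => expSL (ε • ξ n) * L n)) (pairing X ξ) 0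

/-- `X` is the right gradient of `F` at `L`:
`d/dε F (L exp (ε ξ)) = ⟨X, ξ⟩` at `ε = 0`, for all `ξ`. -/
def IsRightGradient {d N : ℕ} [NeZero N] (F : (ZMod N → Grp d) → ℝ) (L : ZMod N → Grp d)
    (X : ZMod N → Alg d) : Prop :=
  ∀ ξ : ZMod N → Alg d,
    HasDerivAt (fun ε : ℝ => F (fun n => L n * expSL (ε • ξ n))) (pairing X ξ) 0

open Classical in
/-- The left gradient `∇F(L)` (zero if it does not exist). -/
def leftGradient {d N : ℕ} [NeZero N] (F : (ZMod N → Grp d) → ℝ) (L : ZMod N → Grp d) :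
    ZMod N → Alg d :=
  if h : ∃ X, IsLeftGradient F L X then h.choose else 0

open Classical in
/-- The right gradient `∇'F(L)` (zero if it does not exist). -/
def rightGradient {d N : ℕ} [NeZero N] (F : (ZMod N → Grp d) → ℝ) (L : ZMod N → Grp d) :
    ZMod N → Alg d :=
  if h : ∃ X, IsRightGradient F L X then h.choose else 0

/-! ### The two gradations -/

/-- Component in `𝔤₊`, the strictly upper triangular matrices. -/
def upper {d : ℕ} (X : Alg d) : Matrix (Fin (d + 1)) (Fin (d + 1)) ℝ :=
  Matrix.of fun i j => if i < j then X.1 i j else 0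

/-- Component in `𝔤₋`, the strictly lower triangular matrices. -/
def lower {d : ℕ} (X : Alg d) : Matrix (Fin (d + 1)) (Fin (d + 1)) ℝ :=
  Matrix.of fun i j => if j < i then X.1 i j else 0

/-- Component in `𝔤₁`: first row without its first entry. -/
def gradeOne {d : ℕ} (X : Alg d) : Matrix (Fin (d + 1)) (Fin (d + 1)) ℝ :=
  Matrix.of fun i j => if i = 0 ∧ j ≠ 0 then X.1 i j else 0

/-- Component in `𝔤₋₁`: first column without its first entry. -/
def gradeNegOne {d : ℕ} (X : Alg d) : Matrix (Fin (d + 1)) (Fin (d + 1)) ℝ :=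
  Matrix.of fun i j => if i ≠ 0 ∧ j = 0 then X.1 i j else 0

/-- The classical `R`-matrix `R(ξ) = (ξ₊ - ξ₋) / 2`. -/
def rMatrix {d : ℕ} (ξ : Alg d) : Matrix (Fin (d + 1)) (Fin (d + 1)) ℝ :=
  (1 / 2 : ℝ) • (upper ξ - lower ξ)

/-- `r(ξ ∧ η) = ⟨ξ, R(η)⟩`. -/
def rWedge {d : ℕ} (ξ η : Alg d) : ℝ := (ξ.1 * rMatrix η).trace

/-- `r(ξ ⊗ η) = ⟨ξ₋, η₊⟩`. -/
def rTensor {d : ℕ} (ξ η : Alg d) : ℝ := (lower ξ * upper η).trace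

/-! ### The two tensors on `G^N` -/

/-- The twisted Semenov-Tian-Shansky Poisson bracket on `G^N`. -/
def twistedBracket {d N : ℕ} [NeZero N] (F K : (ZMod N → Grp d) → ℝ) (L : ZMod N → Grp d) : ℝ :=
  ∑ s, rWedge (leftGradient F L s) (leftGradient K L s)
    + ∑ s, rWedge (rightGradient F L s) (rightGradient K L s)
    - ∑ s, rTensor (rightGradient F L (s + 1)) (leftGradient K L s)
    + ∑ s, rTensor (rightGradient K L (s + 1)) (leftGradient F L s)

/-- The companion tensor `θ` on `G^N` (not itself a Poisson tensor). -/
def companionTensor {d N : ℕ} [NeZero N] (F K : (ZMod N → Grp d) → ℝ) (L : ZMod N → Grp d) : ℝ :=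
  (1 / 2 : ℝ) * ∑ n,
    ((gradeNegOne (rightGradient F L n) * gradeOne (rightGradient K L n)).trace
      - (gradeNegOne (rightGradient K L n) * gradeOne (rightGradient F L n)).trace)

/-! ### The moduli space `G^N / H^N` -/

/-- The subgroup `H ⊆ SL(m, ℝ)` with Lie algebra `𝔤₀ ⊕ 𝔤₁`: the stabilizer of the line
spanned by the first basis vector. -/
def parabolic (d : ℕ) : Subgroup (Grp d) where
  carrier := {h | ∀ i : Fin (d + 1), i ≠ 0 → h.1 i 0 = 0}
  one_mem' := fun i hi => by simp [hi]
  mul_mem' := by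
    intro a b ha hb i hi
    rw [Matrix.SpecialLinearGroup.coe_mul, Matrix.mul_apply]
    refine Finset.sum_eq_zero fun j _ => ?_
    by_cases hj : j = 0
    · rw [hj, ha i hi, zero_mul]
    · rw [hb j hj, mul_zero]
  inv_mem' := by
    intro a ha i hi
    have hcol : ∀ k : Fin (d + 1), (a⁻¹ * a).1 k 0 = a⁻¹.1 k 0 * a.1 0 0 := by
      intro k
      rw [Matrix.SpecialLinearGroup.coe_mul, Matrix.mul_apply]
      refine Finset.sum_eq_single_of_mem 0 (Finset.mem_univ _) fun j _ hj => ?_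
      rw [ha j hj, mul_zero]
    have h0 := hcol 0
    have h1 := hcol i
    rw [inv_mul_cancel, Matrix.SpecialLinearGroup.coe_one] at h0 h1
    rw [Matrix.one_apply_eq] at h0
    rw [Matrix.one_apply_ne hi] at h1
    rcases mul_eq_zero.1 h1.symm with h | h
    · exact h
    · rw [h, mul_zero] at h0
      exact absurd h0 one_ne_zero

/-- The discrete gauge action of `H^N` on `G^N`: `(h, g) ↦ h_{n+1} g_n h_n⁻¹`. -/
def gauge {d N : ℕ} (h : ZMod N → parabolic d) (g : ZMod N → Grp d) : ZMod N → Grp d :=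
  fun n => (h (n + 1) : Grp d) * g n * (h n : Grp d)⁻¹

/-- The coordinate space of the moduli space: the geometric invariants `a_n^r`,
`1 ≤ r ≤ m - 1`, of an arc-length parametrized twisted `N`-gon in `ℝ^m`, given by
`γ_{n+m} = a_n^{m-1} γ_{n+m-1} + ⋯ + a_n^1 γ_{n+1} + (-1)^{m-1} γ_n`
(`a_n^r` is `a n (r - 1)` here). -/
abbrev Invariants (d N : ℕ) : Type := ZMod N → Fin d → ℝ

/-- The inverse Maurer-Cartan matrix with invariants `a`:
the first column is `((-1)^m a, (-1)^{m-1})`, the upper right block is the identity, and the rest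
of the last row vanishes. -/
def frameMatrix {d : ℕ} (a : Fin d → ℝ) : Matrix (Fin (d + 1)) (Fin (d + 1)) ℝ :=
  Matrix.of fun i =>
    (Fin.cons (Fin.snoc (α := fun _ => ℝ) (fun r => (-1) ^ (d + 1) * a r) ((-1) ^ d) i)
      (fun r : Fin d => if i = r.castSucc then 1 else 0) : Fin (d + 1) → ℝ)

theorem det_frameMatrix {d : ℕ} (a : Fin d → ℝ) : (frameMatrix a).det = 1 := by
  rw [Matrix.det_succ_row _ (Fin.last d), Fin.sum_univ_succ]
  have hsub : (frameMatrix a).submatrix (Fin.last d).succAbove (Fin.succAbove 0) = 1 := by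
    ext i j
    simp [frameMatrix, Matrix.one_apply]
  have hz : ∀ r : Fin d, frameMatrix a (Fin.last d) r.succ = 0 := by
    intro r
    simp [frameMatrix, (Fin.castSucc_lt_last r).ne']
  have h0 : frameMatrix a (Fin.last d) 0 = (-1) ^ d := by
    simp [frameMatrix]
  rw [hsub, h0]
  simp [hz, ← mul_pow]

/-- The section `a ↦ L(a)` of `G^N → G^N / H^N` by inverse Maurer-Cartan matrices. -/
def frameSection {d N : ℕ} (a : Invariants d N) : ZMod N → Grp d :=
  fun n => ⟨frameMatrix (a n), det_frameMatrix (a n)⟩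

/-- The union of the gauge orbits that meet the section, i.e. the part of `G^N` that lies over the
moduli space of arc-length parametrized twisted polygons. -/
def regularSet (d N : ℕ) : Set (ZMod N → Grp d) :=
  {L | ∃ (a : Invariants d N) (h : ZMod N → parabolic d), gauge h (frameSection a) = L}

open Classical in
/-- The extension of a function `f` of the invariants to `G^N` that is constant on gauge orbits
(by convention `0` off the orbits that meet the section). -/
def invariantExtension {d N : ℕ} (f : Invariants d N → ℝ) : (ZMod N → Grp d) → ℝ :=
  fun L =>
    if hL : ∃ (a : Invariants d N) (h : ZMod N → parabolic d), gauge h (frameSection a) = L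
    then f hL.choose else 0

/-- `F` is a gauge-invariant extension of `f`, smooth over the moduli space. -/
structure IsInvariantExtension {d N : ℕ} [NeZero N] (f : Invariants d N → ℝ)
    (F : (ZMod N → Grp d) → ℝ) : Prop where
  invariant : ∀ (h : ZMod N → parabolic d) (L : ZMod N → Grp d), F (gauge h L) = F L
  extends_fun : ∀ a : Invariants d N, F (frameSection a) = f a
  smooth : ∀ L ∈ regularSet d N, SmoothAt F L

/-- The reduced twisted bracket `{f, g}_R (a) = {F, G}(L(a))`. -/
def reducedBracket {d N : ℕ} [NeZero N] (f g : Invariants d N → ℝ) : Invariants d N → ℝ :=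
  fun a => twistedBracket (invariantExtension f) (invariantExtension g) (frameSection a)

/-- The reduced companion bracket `{f, g}_0 (a) = θ(F, G)(L(a))`. -/
def companionBracket {d N : ℕ} [NeZero N] (f g : Invariants d N → ℝ) : Invariants d N → ℝ :=
  fun a => companionTensor (invariantExtension f) (invariantExtension g) (frameSection a)

/-! ### Poisson brackets -/

/-- `B` is a Poisson bracket on the algebra of smooth functions on `E`. -/
structure IsPoissonBracket {E : Type*} [NormedAddCommGroup E] [NormedSpace ℝ E]
    (B : (E → ℝ) → (E → ℝ) → (E → ℝ)) : Prop where
  smooth : ∀ f g : E → ℝ, ContDiff ℝ ∞ f → ContDiff ℝ ∞ g → ContDiff ℝ ∞ (B f g)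
  add_left : ∀ f g h : E → ℝ, ContDiff ℝ ∞ f → ContDiff ℝ ∞ g → ContDiff ℝ ∞ h →
    B (f + g) h = B f h + B g h
  smul_left : ∀ (c : ℝ) (f g : E → ℝ), ContDiff ℝ ∞ f → ContDiff ℝ ∞ g →
    B (c • f) g = c • B f g
  skew : ∀ f g : E → ℝ, ContDiff ℝ ∞ f → ContDiff ℝ ∞ g → B f g = -B g f
  leibniz : ∀ f g h : E → ℝ, ContDiff ℝ ∞ f → ContDiff ℝ ∞ g → ContDiff ℝ ∞ h →
    B (f * g) h = f * B g h + g * B f h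
  jacobi : ∀ f g h : E → ℝ, ContDiff ℝ ∞ f → ContDiff ℝ ∞ g → ContDiff ℝ ∞ h →
    B (B f g) h + B (B g h) f + B (B h f) g = 0

/-- Two Poisson brackets are compatible (form a bi-Hamiltonian structure): each of them is a
Poisson bracket and so is every linear combination of them. -/
def AreCompatible {E : Type*} [NormedAddCommGroup E] [NormedSpace ℝ E]
    (B₁ B₂ : (E → ℝ) → (E → ℝ) → (E → ℝ)) : Prop :=
  IsPoissonBracket B₁ ∧ IsPoissonBracket B₂ ∧
    ∀ s t : ℝ, IsPoissonBracket fun f g => s • B₁ f g + t • B₂ f g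

end TwistedPolygon

end

noncomputable section

namespace TwistedPolygon

/-! ### Poisson brackets given by a Hamiltonian operator -/

section HamiltonianOperator

variable {E : Type*} [NormedAddCommGroup E] [NormedSpace ℝ E]

/-! Put m = d + 1. A polygon with invariants a corresponds to the difference operator D = Tᵐ - ∑
aʳTʳ + e with e = (-1)ᵐ. Both reduced brackets come from one family of quadratic brackets, on
operators of this shape with an arbitrary constant term e.

In the double A × A of the algebra of periodic difference operators, with functional tr l - tr r,
take two subalgebras on which the functional vanishes: `UpperPair` and `LowerPair`. Since N and m
are coprime, (DΞ, ΞD) splits as an upper pair (Y, X) plus a lower pair. The field Ξ ↦ YD - DX is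
skew and satisfies the Jacobi identity by pure algebra: products of two or three elements of either
subalgebra still have functional zero (`IsManinPair.skew`, `IsManinPair.jacobi`). The upper
description of the field bounds its degrees from below and the lower one from above, so it is
tangent to the space of operators D (`invariantsOp_hamiltonian`).

A covector operator Ξ has only negative degrees, so (Y, X) does not depend on e, and the Hamiltonian
operator is H₀ + eH₁, with H₁ given by the commutator [D, Ξ] (`hamiltonian_eq`). The Jacobiator is
quadratic in e and vanishes identically; hence every combination sH₀ + tH₁ is Poisson
(`jacobiator_pencil`).

It remains to identify the brackets: {,}_R is H₀ + (-1)ᵐH₁ (`reducedBracket_eq`) and {,}_0 is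
(-1)ᵐH₁/2 (`companionBracket_eq`). On the section, invariance forces the left gradient at n and the
right gradient at n + 1 to agree off the first row; a recursion along diagonals then finds the first
column of the right gradient among the coefficients of ΞD. For {,}_R, difference operators act on
vector sequences with T the shift twisted by L(a)⁻¹; the constant sequence e₁ is cyclic and killed
by D, and this turns YD - DX into a trace of gradients.

The invariant extensions exist and are smooth because the gauge element leading to the section is
recovered from a frame of transported vectors, up to scalars given by an equation that coprimality
makes solvable. -/

theorem contDiff_fderiv_infty {f : E → ℝ} (hf : ContDiff ℝ ∞ f) : ContDiff ℝ ∞ (fderiv ℝ f) :=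
  hf.fderiv_right (by simp)

theorem contDiff_hamiltonian {V : E → (E →L[ℝ] ℝ) →L[ℝ] E} (hV : ContDiff ℝ ∞ V) {f g : E → ℝ}
    (hf : ContDiff ℝ ∞ f) (hg : ContDiff ℝ ∞ g) :
    ContDiff ℝ ∞ fun x => fderiv ℝ f x (V x (fderiv ℝ g x)) :=
  (contDiff_fderiv_infty hf).clm_apply (hV.clm_apply (contDiff_fderiv_infty hg))

theorem fderiv_hamiltonian {V : E → (E →L[ℝ] ℝ) →L[ℝ] E} (hV : ContDiff ℝ ∞ V) {f g : E → ℝ}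
    (hf : ContDiff ℝ ∞ f) (hg : ContDiff ℝ ∞ g) (x v : E) :
    fderiv ℝ (fun x => fderiv ℝ f x (V x (fderiv ℝ g x))) x v =
      fderiv ℝ (fderiv ℝ f) x v (V x (fderiv ℝ g x))
        + fderiv ℝ f x (fderiv ℝ V x v (fderiv ℝ g x))
        + fderiv ℝ f x (V x (fderiv ℝ (fderiv ℝ g) x v)) := by
  have h1 := ((contDiff_fderiv_infty hf).differentiable (by simp) x).hasFDerivAt
  have h2 := ((contDiff_fderiv_infty hg).differentiable (by simp) x).hasFDerivAt
  have h3 := (hV.differentiable (by simp) x).hasFDerivAt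
  rw [(h1.clm_apply (h3.clm_apply h2)).fderiv]
  simp
  ring

theorem fderiv_fderiv_comm {f : E → ℝ} (hf : ContDiff ℝ ∞ f) (x v w : E) :
    fderiv ℝ (fderiv ℝ f) x v w = fderiv ℝ (fderiv ℝ f) x w v :=
  (hf.contDiffAt.isSymmSndFDerivAt
    (by simpa using WithTop.coe_le_coe.2 (le_top : (2 : ℕ∞) ≤ ⊤))).eq v w

/-- A smooth skew-symmetric operator from covectors to vectors whose Jacobiator vanishes on
constant covectors defines a Poisson bracket. -/
theorem isPoissonBracket_of_hamiltonian (V : E → (E →L[ℝ] ℝ) →L[ℝ] E) (hV : ContDiff ℝ ∞ V)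
    (hskew : ∀ (x : E) (ξ η : E →L[ℝ] ℝ), ξ (V x η) = -η (V x ξ))
    (hjac : ∀ (x : E) (ξ η ζ : E →L[ℝ] ℝ),
      ξ (fderiv ℝ V x (V x ζ) η) + η (fderiv ℝ V x (V x ξ) ζ)
      + ζ (fderiv ℝ V x (V x η) ξ) = 0)
    (B : (E → ℝ) → (E → ℝ) → (E → ℝ))
    (hB : ∀ f g, ContDiff ℝ ∞ f → ContDiff ℝ ∞ g →
      B f g = fun x => fderiv ℝ f x (V x (fderiv ℝ g x))) :
    IsPoissonBracket B where
  smooth f g hf hg := by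
    rw [hB f g hf hg]
    exact contDiff_hamiltonian hV hf hg
  add_left f g h hf hg hh := by
    rw [hB (f + g) h (hf.add hg) hh, hB _ _ hf hh, hB _ _ hg hh]
    funext x
    rw [fderiv_add (hf.differentiable (by simp) x) (hg.differentiable (by simp) x)]
    rfl
  smul_left c f g hf hg := by
    rw [hB (c • f) g (hf.const_smul c) hg, hB _ _ hf hg]
    funext x
    rw [fderiv_const_smul (hf.differentiable (by simp) x)]
    rfl
  skew f g hf hg := by
    rw [hB _ _ hf hg, hB _ _ hg hf]
    funext x
    exact hskew x _ _
  leibniz f g h hf hg hh := by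
    rw [hB (f * g) h (hf.mul hg) hh, hB _ _ hf hh, hB _ _ hg hh]
    funext x
    rw [fderiv_mul (hf.differentiable (by simp) x) (hg.differentiable (by simp) x)]
    rfl
  jacobi f g h hf hg hh := by
    have hfg := contDiff_hamiltonian hV hf hg
    have hgh := contDiff_hamiltonian hV hg hh
    have hhf := contDiff_hamiltonian hV hh hf
    rw [hB f g hf hg, hB g h hg hh, hB h f hh hf, hB _ _ hfg hh, hB _ _ hgh hf, hB _ _ hhf hg]
    funext x
    simp only [Pi.add_apply, Pi.zero_apply]
    rw [fderiv_hamiltonian hV hf hg, fderiv_hamiltonian hV hg hh, fderiv_hamiltonian hV hh hf]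
    have hJ := hjac x (fderiv ℝ f x) (fderiv ℝ g x) (fderiv ℝ h x)
    -- The second-derivative terms cancel in pairs: skewness moves the Hessian out of the argument
    -- of V, and the symmetry of Hessians matches it with a term of the next cyclic summand.
    have h1 := hskew x (fderiv ℝ f x) (fderiv ℝ (fderiv ℝ g) x (V x (fderiv ℝ h x)))
    have h2 := hskew x (fderiv ℝ g x) (fderiv ℝ (fderiv ℝ h) x (V x (fderiv ℝ f x)))
    have h3 := hskew x (fderiv ℝ h x) (fderiv ℝ (fderiv ℝ f) x (V x (fderiv ℝ g x)))
    have s1 := fderiv_fderiv_comm hf x (V x (fderiv ℝ h x)) (V x (fderiv ℝ g x))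
    have s2 := fderiv_fderiv_comm hg x (V x (fderiv ℝ f x)) (V x (fderiv ℝ h x))
    have s3 := fderiv_fderiv_comm hh x (V x (fderiv ℝ g x)) (V x (fderiv ℝ f x))
    linarith

/-- If `V₀ + e V₁` has vanishing Jacobiator for `e = 0, 1, -1`, then so does every linear
combination of `V₀` and `V₁`. -/
theorem jacobiator_pencil (V₀ V₁ : E → (E →L[ℝ] ℝ) →L[ℝ] E) (h₀ : ContDiff ℝ ∞ V₀)
    (h₁ : ContDiff ℝ ∞ V₁)
    (hjac : ∀ (e : ℝ) (x : E) (ξ η ζ : E →L[ℝ] ℝ),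
      ξ (fderiv ℝ (V₀ + e • V₁) x ((V₀ + e • V₁) x ζ) η)
      + η (fderiv ℝ (V₀ + e • V₁) x ((V₀ + e • V₁) x ξ) ζ)
      + ζ (fderiv ℝ (V₀ + e • V₁) x ((V₀ + e • V₁) x η) ξ) = 0) (s t : ℝ) (x : E)
    (ξ η ζ : E →L[ℝ] ℝ) :
    ξ (fderiv ℝ (s • V₀ + t • V₁) x ((s • V₀ + t • V₁) x ζ) η)
      + η (fderiv ℝ (s • V₀ + t • V₁) x ((s • V₀ + t • V₁) x ξ) ζ)
      + ζ (fderiv ℝ (s • V₀ + t • V₁) x ((s • V₀ + t • V₁) x η) ξ) = 0 := by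
  have d₀ := h₀.differentiable (by simp) x
  have d₁ := h₁.differentiable (by simp) x
  have hsum : ∀ s t : ℝ, fderiv ℝ (s • V₀ + t • V₁) x
      = s • fderiv ℝ V₀ x + t • fderiv ℝ V₁ x := fun s t => by
    rw [fderiv_add (d₀.const_smul s) (d₁.const_smul t), fderiv_const_smul d₀,
      fderiv_const_smul d₁]
  have hsum' : ∀ e : ℝ, fderiv ℝ (V₀ + e • V₁) x = fderiv ℝ V₀ x + e • fderiv ℝ V₁ x :=
    fun e => by
      rw [fderiv_add d₀ (d₁.const_smul e), fderiv_const_smul d₁]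
  have a0 := hjac 0 x ξ η ζ
  have a1 := hjac 1 x ξ η ζ
  have a2 := hjac (-1) x ξ η ζ
  rw [hsum'] at a0 a1 a2
  rw [hsum]
  simp only [Pi.add_apply, Pi.smul_apply, _root_.add_apply,
    _root_.smul_apply, map_add, map_smul, smul_eq_mul] at a0 a1 a2 ⊢
  -- The Jacobiator of sV₀ + tV₁ is s²J₀₀ + stJ₀₁ + t²J₁₁, where J₀₀ = a0, J₀₁ = (a1 - a2)/2 and J₁₁
  -- = (a1 + a2)/2 - a0.
  linear_combination (s ^ 2 - t ^ 2) * a0 + (s * t + t ^ 2) / 2 * a1 + (t ^ 2 - s * t) / 2 * a2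

end HamiltonianOperator

/-! ### Quadratic brackets on an associative algebra -/

section ManinTriple

variable {A : Type*} [Ring A] (tr : A →+ ℝ)

/-- The functional `(l, r) ↦ tr l - tr r` on the double `A × A`. -/
def doubleTrace : A × A →+ ℝ :=
  tr.comp (AddMonoidHom.fst A A) - tr.comp (AddMonoidHom.snd A A)

theorem doubleTrace_apply (p : A × A) : doubleTrace tr p = tr p.1 - tr p.2 := rfl

/-- A pair of subalgebras of the double of an associative algebra on which the functional
`(l, r) ↦ tr l - tr r` vanishes. -/
structure IsManinPair (S₁ S₂ : A × A → Prop) : Prop where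
  trace_comm : ∀ x y, tr (x * y) = tr (y * x)
  mul_left : ∀ p q, S₁ p → S₁ q → S₁ (p * q)
  mul_right : ∀ p q, S₂ p → S₂ q → S₂ (p * q)
  trace_left : ∀ p, S₁ p → doubleTrace tr p = 0
  trace_right : ∀ p, S₂ p → doubleTrace tr p = 0

variable {tr} {S₁ S₂ : A × A → Prop}

theorem IsManinPair.rotate (h : IsManinPair tr S₁ S₂) (x y z : A) :
    tr (x * y * z) = tr (y * z * x) := by
  rw [mul_assoc, h.trace_comm]

/-- The quadratic bracket `tr (Ξ (Y D - D X))` is skew-symmetric. -/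
theorem IsManinPair.skew (h : IsManinPair tr S₁ S₂) {D Ξ₁ Ξ₂ : A}
    {p₁ p₂ : A × A} (h₁ : S₁ p₁) (h₂ : S₁ p₂)
    (g₁ : S₂ ((D * Ξ₁, Ξ₁ * D) - p₁)) (g₂ : S₂ ((D * Ξ₂, Ξ₂ * D) - p₂)) :
    tr (Ξ₁ * (p₂.1 * D - D * p₂.2)) = -tr (Ξ₂ * (p₁.1 * D - D * p₁.2)) := by
  -- With wᵢ = (DΞᵢ, ΞᵢD), the functional vanishes on (w₁ - p₁)(w₂ - p₂), on p₁p₂, and on w₁w₂ by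
  -- cyclicity. So its values on w₁p₂ and p₁w₂ are opposite, which is the claim.
  have a := h.trace_right _ (h.mul_right _ _ g₁ g₂)
  have b := h.trace_left _ (h.mul_left _ _ h₁ h₂)
  have c₁ : tr (D * Ξ₁ * (D * Ξ₂)) = tr (Ξ₁ * D * (Ξ₂ * D)) := by
    rw [mul_assoc, h.trace_comm]; simp only [mul_assoc]
  have c₂ : tr (Ξ₁ * (p₂.1 * D)) = tr (D * Ξ₁ * p₂.1) := by
    rw [mul_assoc, h.trace_comm D]; simp only [mul_assoc]
  have c₃ : tr (Ξ₂ * (p₁.1 * D)) = tr (p₁.1 * (D * Ξ₂)) := by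
    rw [h.trace_comm]; simp only [mul_assoc]
  have c₄ : tr (Ξ₂ * (D * p₁.2)) = tr (p₁.2 * (Ξ₂ * D)) := by
    rw [← mul_assoc, h.trace_comm]
  simp only [doubleTrace_apply, Prod.fst_mul, Prod.snd_mul,
    mul_sub, sub_mul, map_sub] at a b ⊢
  rw [c₂, c₃, c₄, ← mul_assoc Ξ₁ D]
  linarith

/-- Isotropy of the two subalgebras, applied to p₁ and c and to their lower complements, eliminates
c (the derivative of p₂). What remains involves only D, the Ξ's and the upper parts themselves. -/
theorem IsManinPair.jacobi_term (h : IsManinPair tr S₁ S₂) {D Ξ₁ Ξ₂ : A}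
    {p₁ p₂ p₃ c : A × A} (h₁ : S₁ p₁) (g₁ : S₂ ((D * Ξ₁, Ξ₁ * D) - p₁)) (hc : S₁ c)
    (gc : S₂ (((p₃.1 * D - D * p₃.2) * Ξ₂, Ξ₂ * (p₃.1 * D - D * p₃.2)) - c)) :
    tr (Ξ₁ * (c.1 * D - D * c.2 + p₂.1 * (p₃.1 * D - D * p₃.2)
        - (p₃.1 * D - D * p₃.2) * p₂.2)) =
      tr ((D * Ξ₂) * (D * Ξ₁) * p₃.1) - tr ((Ξ₂ * D) * (Ξ₁ * D) * p₃.2)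
      - tr ((D * Ξ₁) * (D * Ξ₂) * p₃.1) + tr ((Ξ₁ * D) * (Ξ₂ * D) * p₃.2)
      - tr (p₁.1 * p₃.1 * (D * Ξ₂)) - tr (p₃.2 * p₁.2 * (Ξ₂ * D))
      + tr (p₂.1 * p₃.1 * (D * Ξ₁)) + tr (p₃.2 * p₂.2 * (Ξ₁ * D))
      + tr (p₁.1 * D * p₃.2 * Ξ₂) + tr (p₃.1 * D * p₁.2 * Ξ₂)
      - tr (p₂.1 * D * p₃.2 * Ξ₁) - tr (p₃.1 * D * p₂.2 * Ξ₁) := by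
  have a := h.trace_right _ (h.mul_right _ _ g₁ gc)
  have b := h.trace_left _ (h.mul_left _ _ h₁ hc)
  simp only [doubleTrace_apply, Prod.fst_mul, Prod.snd_mul,
    mul_sub, sub_mul, mul_add, map_sub, map_add, ← mul_assoc] at a b ⊢
  have e₁ : tr (Ξ₁ * c.1 * D) = tr (D * Ξ₁ * c.1) := by
    rw [h.trace_comm]; simp only [mul_assoc]
  have e₂ : tr (Ξ₁ * p₂.1 * p₃.1 * D) = tr (p₂.1 * p₃.1 * D * Ξ₁) := by
    rw [mul_assoc, mul_assoc, h.trace_comm]; simp only [mul_assoc]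
  have e₃ : tr (Ξ₁ * p₂.1 * D * p₃.2) = tr (p₂.1 * D * p₃.2 * Ξ₁) := by
    rw [mul_assoc, mul_assoc, h.trace_comm]; simp only [mul_assoc]
  have e₄ : tr (Ξ₁ * p₃.1 * D * p₂.2) = tr (p₃.1 * D * p₂.2 * Ξ₁) := by
    rw [mul_assoc, mul_assoc, h.trace_comm]; simp only [mul_assoc]
  have e₅ : tr (Ξ₁ * D * p₃.2 * p₂.2) = tr (p₃.2 * p₂.2 * Ξ₁ * D) := by
    rw [mul_assoc, h.trace_comm]; simp only [mul_assoc]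
  have e₆ : tr (D * Ξ₁ * p₃.1 * D * Ξ₂) = tr (D * Ξ₂ * D * Ξ₁ * p₃.1) := by
    rw [mul_assoc, h.trace_comm]; simp only [mul_assoc]
  have e₇ : tr (D * Ξ₁ * D * p₃.2 * Ξ₂) = tr (Ξ₂ * D * Ξ₁ * D * p₃.2) := by
    rw [h.trace_comm]; simp only [mul_assoc]
  have e₈ : tr (Ξ₁ * D * Ξ₂ * p₃.1 * D) = tr (D * Ξ₁ * D * Ξ₂ * p₃.1) := by
    rw [h.trace_comm]; simp only [mul_assoc]
  have e₉ : tr (p₁.2 * Ξ₂ * p₃.1 * D) = tr (p₃.1 * D * p₁.2 * Ξ₂) := by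
    rw [mul_assoc, h.trace_comm]; simp only [mul_assoc]
  have e₁₀ : tr (p₁.2 * Ξ₂ * D * p₃.2) = tr (p₃.2 * p₁.2 * Ξ₂ * D) := by
    rw [h.trace_comm]; simp only [mul_assoc]
  linarith

/-- The Jacobi identity for the quadratic bracket `tr (Ξ (Y D - D X))`; the pair `cᵢⱼ` is the
derivative of `pᵢ` in the direction `pⱼ.1 D - D pⱼ.2`. -/
theorem IsManinPair.jacobi (h : IsManinPair tr S₁ S₂) {D Ξ₁ Ξ₂ Ξ₃ : A}
    {p₁ p₂ p₃ c₁₂ c₂₃ c₃₁ : A × A}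
    (h₁ : S₁ p₁) (h₂ : S₁ p₂) (h₃ : S₁ p₃)
    (g₁ : S₂ ((D * Ξ₁, Ξ₁ * D) - p₁)) (g₂ : S₂ ((D * Ξ₂, Ξ₂ * D) - p₂))
    (g₃ : S₂ ((D * Ξ₃, Ξ₃ * D) - p₃))
    (hc₂₃ : S₁ c₂₃) (hc₃₁ : S₁ c₃₁) (hc₁₂ : S₁ c₁₂)
    (gc₂₃ : S₂ (((p₃.1 * D - D * p₃.2) * Ξ₂, Ξ₂ * (p₃.1 * D - D * p₃.2)) - c₂₃))
    (gc₃₁ : S₂ (((p₁.1 * D - D * p₁.2) * Ξ₃, Ξ₃ * (p₁.1 * D - D * p₁.2)) - c₃₁))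
    (gc₁₂ : S₂ (((p₂.1 * D - D * p₂.2) * Ξ₁, Ξ₁ * (p₂.1 * D - D * p₂.2)) - c₁₂)) :
    tr (Ξ₁ * (c₂₃.1 * D - D * c₂₃.2 + p₂.1 * (p₃.1 * D - D * p₃.2)
        - (p₃.1 * D - D * p₃.2) * p₂.2))
      + tr (Ξ₂ * (c₃₁.1 * D - D * c₃₁.2 + p₃.1 * (p₁.1 * D - D * p₁.2)
        - (p₁.1 * D - D * p₁.2) * p₃.2))
      + tr (Ξ₃ * (c₁₂.1 * D - D * c₁₂.2 + p₁.1 * (p₂.1 * D - D * p₂.2)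
        - (p₂.1 * D - D * p₂.2) * p₁.2)) = 0 := by
  rw [h.jacobi_term h₁ g₁ hc₂₃ gc₂₃, h.jacobi_term h₂ g₂ hc₃₁ gc₃₁,
    h.jacobi_term h₃ g₃ hc₁₂ gc₁₂]
  have key : ∀ {l₁ l₂ l₃ y₁ y₂ y₃ : A}, tr ((l₁ - y₁) * (l₂ - y₂) * (l₃ - y₃)) =
      tr (l₁ * l₂ * l₃) - tr (l₁ * l₂ * y₃) - tr (l₂ * l₃ * y₁) - tr (l₃ * l₁ * y₂)
      + tr (y₁ * y₂ * l₃) + tr (y₂ * y₃ * l₁) + tr (y₃ * y₁ * l₂) - tr (y₁ * y₂ * y₃) := by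
    intro l₁ l₂ l₃ y₁ y₂ y₃
    simp only [mul_sub, sub_mul, map_sub]
    linarith [h.rotate y₁ l₂ l₃, h.rotate l₃ l₁ y₂, h.rotate y₃ y₁ l₂, h.rotate l₁ y₂ y₃]
  -- The trace of a triple product is only cyclically invariant, so both cyclic orders of the three
  -- factors are used, in each subalgebra.
  have a := h.trace_right _ (h.mul_right _ _ (h.mul_right _ _ g₁ g₂) g₃)
  have a' := h.trace_right _ (h.mul_right _ _ (h.mul_right _ _ g₁ g₃) g₂)
  have b := h.trace_left _ (h.mul_left _ _ (h.mul_left _ _ h₁ h₂) h₃)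
  have b' := h.trace_left _ (h.mul_left _ _ (h.mul_left _ _ h₁ h₃) h₂)
  have w : ∀ Ξ Ξ' Ξ'' : A, tr (D * Ξ * (D * Ξ') * (D * Ξ'')) =
      tr (Ξ * D * (Ξ' * D) * (Ξ'' * D)) := by
    intro Ξ Ξ' Ξ''
    rw [show D * Ξ * (D * Ξ') * (D * Ξ'') = D * (Ξ * D * Ξ' * D * Ξ'') by
      simp only [mul_assoc], h.trace_comm]
    simp only [mul_assoc]
  have w₁ := w Ξ₁ Ξ₂ Ξ₃
  have w₂ := w Ξ₁ Ξ₃ Ξ₂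
  simp only [doubleTrace_apply, Prod.fst_mul, Prod.snd_mul, Prod.fst_sub, Prod.snd_sub, key]
    at a a' b b'
  linarith

end ManinTriple

/-! ### Difference operators with periodic coefficients -/

section DifferenceOperators

variable {N : ℕ}

/-- This action encodes the commutation rule T x = (shift 1 x) T in the skew algebra below. -/
instance shiftAction (N : ℕ) : MulSemiringAction (Multiplicative ℤ) (ZMod N → ℝ) where
  smul g x := fun n => x (n + (g.toAdd : ZMod N))
  one_smul x := by funext n; exact congrArg x (by simp)
  mul_smul g h x := by
    funext n
    refine congrArg x ?_
    simp [add_assoc]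
  smul_zero _ := rfl
  smul_add _ _ _ := rfl
  smul_one _ := rfl
  smul_mul _ _ _ := rfl

/-- Difference operators `∑ₖ xₖ Tᵏ` with `N`-periodic coefficients, `T` being the shift. -/
abbrev DiffOp (N : ℕ) : Type := SkewMonoidAlgebra (ZMod N → ℝ) (Multiplicative ℤ)

/-- The shift of a periodic sequence by `k`. -/
def shift (k : ℤ) : (ZMod N → ℝ) →ₗ[ℝ] (ZMod N → ℝ) where
  toFun x := fun n => x (n + (k : ZMod N))
  map_add' _ _ := rfl
  map_smul' _ _ := rfl

theorem shift_apply (k : ℤ) (x : ZMod N → ℝ) (n : ZMod N) :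
    shift k x n = x (n + (k : ZMod N)) := rfl

theorem shift_zero (x : ZMod N → ℝ) : shift 0 x = x := by
  funext n; simp [shift_apply]

theorem shift_mul (k : ℤ) (x y : ZMod N → ℝ) : shift k (x * y) = shift k x * shift k y := rfl

theorem shift_shift (j k : ℤ) (x : ZMod N → ℝ) : shift j (shift k x) = shift (j + k) x := by
  funext n; simp [shift_apply, add_assoc]

theorem sum_shift [NeZero N] (k : ℤ) (x : ZMod N → ℝ) : ∑ n, shift k x n = ∑ n, x n :=
  Equiv.sum_comp (Equiv.addRight (k : ZMod N)) x

/-- The coefficient of `Tᵏ`. -/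
def co (k : ℤ) : DiffOp N →ₗ[ℝ] (ZMod N → ℝ) where
  toFun x := x.coeff (Multiplicative.ofAdd k)
  map_add' _ _ := by simp
  map_smul' _ _ := by simp

/-- The monomial `x Tᵏ`. -/
def mono (k : ℤ) : (ZMod N → ℝ) →ₗ[ℝ] DiffOp N where
  toFun x := SkewMonoidAlgebra.single (Multiplicative.ofAdd k) x
  map_add' _ _ := by simp
  map_smul' _ _ := by simp [SkewMonoidAlgebra.smul_single]

theorem diffOp_ext {x y : DiffOp N} (h : ∀ k, co k x = co k y) : x = y :=
  SkewMonoidAlgebra.ext fun g => h g.toAdd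

theorem diffOp_induction {p : DiffOp N → Prop} (x : DiffOp N) (hm : ∀ k y, p (mono k y))
    (ha : ∀ x y, p x → p y → p (x + y)) : p x :=
  SkewMonoidAlgebra.induction_on x (by simpa [mono] using hm 0 0)
    (fun g y => hm g.toAdd y) fun x y => ha x y

theorem co_mono (j k : ℤ) (x : ZMod N → ℝ) : co j (mono k x) = if j = k then x else 0 := by
  classical
  change (SkewMonoidAlgebra.single (Multiplicative.ofAdd k) x).coeff (Multiplicative.ofAdd j) = _
  rw [SkewMonoidAlgebra.coeff_single_apply]
  simp [eq_comm]

theorem co_mono_mul (j k : ℤ) (x : ZMod N → ℝ) (y : DiffOp N) :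
    co j (mono k x * y) = x * shift k (co (j - k) y) := by
  change (SkewMonoidAlgebra.single (Multiplicative.ofAdd k) x * y).coeff _ = _
  rw [SkewMonoidAlgebra.coeff_single_mul, neg_add_eq_sub k j |>.symm]
  rfl

theorem co_mul_mono (j k : ℤ) (x : ZMod N → ℝ) (y : DiffOp N) :
    co j (y * mono k x) = co (j - k) y * shift (j - k) x := by
  change (y * SkewMonoidAlgebra.single (Multiplicative.ofAdd k) x).coeff _ = _
  rw [SkewMonoidAlgebra.coeff_mul_single]
  rfl

theorem mono_zero_one : mono 0 1 = (1 : DiffOp N) := rfl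

/-- Real constants are fixed by the shift, hence central, although the coefficient ring ℝ^N is not.
-/
instance : IsScalarTower ℝ (DiffOp N) (DiffOp N) where
  smul_assoc c x y := by
    simp only [smul_eq_mul]
    induction x using diffOp_induction with
    | hm k x =>
      refine diffOp_ext fun j => ?_
      rw [← map_smul, map_smul (co j), co_mono_mul, co_mono_mul, smul_mul_assoc]
    | ha x x' hx hx' => rw [smul_add, add_mul, add_mul, smul_add, hx, hx']

instance : SMulCommClass ℝ (DiffOp N) (DiffOp N) where
  smul_comm c x y := by
    simp only [smul_eq_mul]
    induction x using diffOp_induction with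
    | hm k x =>
      refine diffOp_ext fun j => ?_
      rw [map_smul (co j), co_mono_mul, co_mono_mul, map_smul, map_smul, mul_smul_comm]
    | ha x x' hx hx' => rw [add_mul, add_mul, smul_add, hx, hx']

theorem exists_finset_co_mul (x y : DiffOp N) : ∃ s : Finset ℤ, (∀ i ∉ s, co i x = 0) ∧
    ∀ k, co k (x * y) = ∑ i ∈ s, co i x * shift i (co (k - i) y) := by
  refine ⟨x.support.map ⟨Multiplicative.toAdd, Multiplicative.toAdd.injective⟩,
    fun i hi => ?_, fun k => ?_⟩
  · by_contra h
    exact hi (Finset.mem_map_of_mem _ (SkewMonoidAlgebra.mem_support_iff.2 h))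
  · rw [Finset.sum_map]
    change (x * y).coeff _ = _
    rw [SkewMonoidAlgebra.coeff_mul_left]
    refine Finset.sum_congr rfl fun g _ => ?_
    rw [neg_add_eq_sub _ k |>.symm]
    rfl

theorem co_mul_of_le {a b : ℤ} {x y : DiffOp N} (hx : ∀ k < a, co k x = 0)
    (hy : ∀ k < b, co k y = 0) :
    (∀ k < a + b, co k (x * y) = 0) ∧ co (a + b) (x * y) = co a x * shift a (co b y) := by
  obtain ⟨s, hs₀, hs⟩ := exists_finset_co_mul x y
  have hz : ∀ k i : ℤ, k ≤ a + b → (k < a + b ∨ i ≠ a) →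
      co i x * shift i (co (k - i) y) = 0 := by
    intro k i hk hi
    by_cases h : i < a
    · rw [hx i h, zero_mul]
    · rw [hy (k - i) (by omega), map_zero, mul_zero]
  refine ⟨fun k hk => ?_, ?_⟩
  · rw [hs]
    exact Finset.sum_eq_zero fun i _ => hz k i hk.le (Or.inl hk)
  · rw [hs, Finset.sum_eq_single a (fun i _ hi => hz _ i le_rfl (Or.inr hi))
      fun ha => by rw [hs₀ a ha, zero_mul], add_sub_cancel_left]

theorem co_mul_of_ge {a b : ℤ} {x y : DiffOp N} (hx : ∀ k, a < k → co k x = 0)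
    (hy : ∀ k, b < k → co k y = 0) :
    (∀ k, a + b < k → co k (x * y) = 0) ∧ co (a + b) (x * y) = co a x * shift a (co b y) := by
  obtain ⟨s, hs₀, hs⟩ := exists_finset_co_mul x y
  have hz : ∀ k i : ℤ, a + b ≤ k → (a + b < k ∨ i ≠ a) →
      co i x * shift i (co (k - i) y) = 0 := by
    intro k i hk hi
    by_cases h : a < i
    · rw [hx i h, zero_mul]
    · rw [hy (k - i) (by omega), map_zero, mul_zero]
  refine ⟨fun k hk => ?_, ?_⟩
  · rw [hs]
    exact Finset.sum_eq_zero fun i _ => hz k i hk.le (Or.inl hk)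
  · rw [hs, Finset.sum_eq_single a (fun i _ hi => hz _ i le_rfl (Or.inr hi))
      fun ha => by rw [hs₀ a ha, zero_mul], add_sub_cancel_left]

/-- The trace of a difference operator: the sum of the coefficients of `T⁰`. -/
def opTrace [NeZero N] : DiffOp N →ₗ[ℝ] ℝ :=
  (∑ n, LinearMap.proj n : (ZMod N → ℝ) →ₗ[ℝ] ℝ) ∘ₗ co 0

theorem opTrace_apply [NeZero N] (x : DiffOp N) : opTrace x = ∑ n, co 0 x n := by
  simp [opTrace]

theorem opTrace_mono_mul [NeZero N] (k : ℤ) (x : ZMod N → ℝ) (y : DiffOp N) :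
    opTrace (mono k x * y) = ∑ n, x n * shift k (co (-k) y) n := by
  rw [opTrace_apply, co_mono_mul, zero_sub]
  rfl

/-- The constant coefficients of xTᵏ·y and y·xTᵏ differ by a shift, which the sum over a period does
not see. -/
theorem opTrace_mul_comm [NeZero N] (x y : DiffOp N) : opTrace (x * y) = opTrace (y * x) := by
  induction x using diffOp_induction with
  | hm k x =>
    rw [opTrace_mono_mul, opTrace_apply, co_mul_mono, zero_sub, ← sum_shift (-k)]
    refine Finset.sum_congr rfl fun n _ => ?_
    rw [Pi.mul_apply, mul_comm]
    simp [shift_apply, add_assoc]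
  | ha x x' hx hz => rw [add_mul, mul_add, map_add, map_add, hx, hz]

/-- The part of positive degree. -/
def posPart : DiffOp N →ₗ[ℝ] DiffOp N where
  toFun x := ⟨x.coeff.filter fun g => 0 < g.toAdd⟩
  map_add' x y := by
    refine diffOp_ext fun k => ?_
    simp [co]
  map_smul' c x := by
    refine diffOp_ext fun k => ?_
    simp [co]

theorem co_posPart (k : ℤ) (x : DiffOp N) : co k (posPart x) = if 0 < k then co k x else 0 := by
  change (x.coeff.filter fun g => 0 < g.toAdd) (Multiplicative.ofAdd k) = _
  rw [Finsupp.filter_apply]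
  rfl

end DifferenceOperators

/-! ### The Hamiltonian operators of the lattice `W`-algebra -/

section ManinPair

variable {N : ℕ}

/-- Pairs of operators of nonnegative degree with the same leading coefficient. -/
def UpperPair (p : DiffOp N × DiffOp N) : Prop :=
  (∀ k < 0, co k p.1 = 0) ∧ (∀ k < 0, co k p.2 = 0) ∧ co 0 p.1 = co 0 p.2

/-- Pairs of operators of nonpositive degree with leading coefficients intertwined by `Tᵐ`. -/
def LowerPair (m : ℤ) (p : DiffOp N × DiffOp N) : Prop :=
  (∀ k, 0 < k → co k p.1 = 0) ∧ (∀ k, 0 < k → co k p.2 = 0) ∧ co 0 p.1 = shift m (co 0 p.2)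

/-- For operators with one-sided degrees the constant coefficient is multiplicative. Equality of
constant coefficients and equality up to Tᵐ both pass to products, and either one makes the two
traces equal. -/
theorem isManinPair [NeZero N] (m : ℤ) :
    IsManinPair (opTrace (N := N)).toAddMonoidHom UpperPair (LowerPair m) where
  trace_comm := opTrace_mul_comm
  mul_left := by
    rintro p q ⟨hp, hp', hp₀⟩ ⟨hq, hq', hq₀⟩
    obtain ⟨h, h₀⟩ := co_mul_of_le hp hq
    obtain ⟨h', h₀'⟩ := co_mul_of_le hp' hq'
    simp only [add_zero] at h h₀ h' h₀'
    exact ⟨h, h', by rw [Prod.fst_mul, Prod.snd_mul, h₀, h₀', hp₀, hq₀]⟩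
  mul_right := by
    rintro p q ⟨hp, hp', hp₀⟩ ⟨hq, hq', hq₀⟩
    obtain ⟨h, h₀⟩ := co_mul_of_ge hp hq
    obtain ⟨h', h₀'⟩ := co_mul_of_ge hp' hq'
    simp only [add_zero] at h h₀ h' h₀'
    exact ⟨h, h', by
      rw [Prod.fst_mul, Prod.snd_mul, h₀, h₀', hp₀, hq₀, shift_zero, shift_zero, shift_mul]⟩
  trace_left := by
    rintro p ⟨-, -, hp₀⟩
    change opTrace p.1 - opTrace p.2 = 0
    rw [opTrace_apply, opTrace_apply, hp₀, sub_self]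
  trace_right := by
    rintro p ⟨-, -, hp₀⟩
    change opTrace p.1 - opTrace p.2 = 0
    rw [opTrace_apply, opTrace_apply, hp₀, sum_shift, sub_self]

theorem sum_range_natCast [NeZero N] (g : ZMod N → ℝ) :
    ∑ j ∈ Finset.range N, g (j : ZMod N) = ∑ z, g z :=
  Finset.sum_nbij' (fun j => (j : ZMod N)) ZMod.val (fun _ _ => Finset.mem_univ _)
    (fun z _ => Finset.mem_range.2 z.val_lt)
    (fun _ hj => ZMod.val_cast_of_lt (Finset.mem_range.1 hj))
    (fun z _ => ZMod.natCast_zmod_val z) (fun _ _ => rfl)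

/-- A solution operator for the equation `y - Tᵐ y = x` on sequences of sum zero. -/
def solveShift (N : ℕ) (m : ℤ) : (ZMod N → ℝ) →ₗ[ℝ] (ZMod N → ℝ) :=
  -((N : ℝ)⁻¹ • ∑ j ∈ Finset.range N, (j : ℝ) • shift (j * m))

/-- Summation by parts along n, n + m, n + 2m, …: with sⱼ = x(n + jm), the sums of j·sⱼ₊₁ and j·sⱼ
over 0 ≤ j < N differ by N·s_N minus the sum of the sⱼ₊₁. -/
theorem solveShift_sub_shift [NeZero N] {m : ℕ} (hm : Nat.Coprime N m) {x : ZMod N → ℝ}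
    (hx : ∑ n, x n = 0) : solveShift N m x - shift m (solveShift N m x) = x := by
  funext n
  have hN : (N : ℝ) ≠ 0 := Nat.cast_ne_zero.2 (NeZero.ne N)
  set s : ℕ → ℝ := fun j => x (n + (j : ZMod N) * m) with hs
  have e₁ : solveShift N m x n = -((N : ℝ)⁻¹ * ∑ j ∈ Finset.range N, (j : ℝ) * s j) := by
    simp [solveShift, shift_apply, hs]
  have e₂ : shift m (solveShift N m x) n =
      -((N : ℝ)⁻¹ * ∑ j ∈ Finset.range N, (j : ℝ) * s (j + 1)) := by
    simp [solveShift, shift_apply, hs, add_mul, add_assoc, add_comm]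
  have e₃ : ∑ j ∈ Finset.range N, ((j + 1 : ℕ) : ℝ) * s (j + 1) =
      ∑ j ∈ Finset.range N, (j : ℝ) * s j + N * s N := by
    have h₁ := Finset.sum_range_succ (fun j => (j : ℝ) * s j) N
    have h₂ := Finset.sum_range_succ' (fun j => (j : ℝ) * s j) N
    simp only [Nat.cast_zero, zero_mul, add_zero] at h₂
    rw [← h₂, h₁]
  -- By coprimality the progression of step m visits each residue exactly once, so this is the full
  -- sum of x.
  have e₄ : ∑ j ∈ Finset.range N, s (j + 1) = 0 := by
    have hu : IsUnit (m : ZMod N) := (ZMod.isUnit_iff_coprime m N).2 hm.symm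
    have h₁ : ∑ j ∈ Finset.range N, s (j + 1) = ∑ z : ZMod N, x (n + (z + 1) * m) := by
      rw [← sum_range_natCast fun z : ZMod N => x (n + (z + 1) * m)]
      simp [hs]
    have h₂ : Function.Bijective fun z : ZMod N => n + (z + 1) * m := by
      refine Finite.injective_iff_bijective.1 fun z w h => ?_
      simpa using hu.mul_right_cancel (add_left_cancel h)
    rw [h₁, h₂.sum_comp x, hx]
  have e₅ : s N = x n := by simp [hs]
  have e₆ : ∑ j ∈ Finset.range N, ((j + 1 : ℕ) : ℝ) * s (j + 1) =
      ∑ j ∈ Finset.range N, (j : ℝ) * s (j + 1) + ∑ j ∈ Finset.range N, s (j + 1) := by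
    rw [← Finset.sum_add_distrib]
    exact Finset.sum_congr rfl fun j _ => by push_cast; ring
  rw [Pi.sub_apply, e₁, e₂]
  have e₇ : ∑ j ∈ Finset.range N, (j : ℝ) * s (j + 1) =
      ∑ j ∈ Finset.range N, (j : ℝ) * s j + N * x n := by
    rw [← e₅, ← e₃, e₆, e₄, add_zero]
  rw [e₇]
  field_simp
  ring

/-- The common leading coefficient of the upper part of `(D Ξ, Ξ D)`. -/
def gaugeCoeff (m : ℤ) (D Ξ : DiffOp N) : ZMod N → ℝ :=
  solveShift N m (co 0 (D * Ξ) - shift m (co 0 (Ξ * D)))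

/-- The component of `(D Ξ, Ξ D)` in the pairs of nonnegative degree. -/
def upperPart (m : ℤ) : DiffOp N →ₗ[ℝ] DiffOp N →ₗ[ℝ] DiffOp N × DiffOp N :=
  LinearMap.mk₂ ℝ (fun D Ξ => (posPart (D * Ξ) + mono 0 (gaugeCoeff m D Ξ),
      posPart (Ξ * D) + mono 0 (gaugeCoeff m D Ξ)))
    (fun D D' Ξ => by
      simp only [gaugeCoeff, add_mul, mul_add, map_add, map_sub, Prod.mk_add_mk, Prod.mk.injEq]
      constructor <;> abel)
    (fun c D Ξ => by
      simp only [gaugeCoeff, smul_mul_assoc, mul_smul_comm, map_smul, map_sub, Prod.smul_mk,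
        smul_add, smul_sub])
    (fun D Ξ Ξ' => by
      simp only [gaugeCoeff, add_mul, mul_add, map_add, map_sub, Prod.mk_add_mk, Prod.mk.injEq]
      constructor <;> abel)
    (fun c D Ξ => by
      simp only [gaugeCoeff, smul_mul_assoc, mul_smul_comm, map_smul, map_sub, Prod.smul_mk,
        smul_add, smul_sub])

theorem upperPart_apply (m : ℤ) (D Ξ : DiffOp N) :
    upperPart m D Ξ = (posPart (D * Ξ) + mono 0 (gaugeCoeff m D Ξ),
      posPart (Ξ * D) + mono 0 (gaugeCoeff m D Ξ)) := rfl

theorem upperPair_upperPart (m : ℤ) (D Ξ : DiffOp N) : UpperPair (upperPart m D Ξ) := by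
  rw [upperPart_apply]
  refine ⟨fun k hk => ?_, fun k hk => ?_, ?_⟩
  · simp [co_posPart, co_mono, hk.ne, hk.le.not_gt]
  · simp [co_posPart, co_mono, hk.ne, hk.le.not_gt]
  · simp [co_posPart, co_mono]

/-- Subtracting a common constant term c leaves a lower pair exactly when c - Tᵐc = co₀(DΞ) -
Tᵐco₀(ΞD). The right side has sum zero because tr DΞ = tr ΞD, so `solveShift` solves the equation.
-/
theorem lowerPair_sub_upperPart [NeZero N] {m : ℕ} (hm : Nat.Coprime N m) (D Ξ : DiffOp N) :
    LowerPair m ((D * Ξ, Ξ * D) - upperPart m D Ξ) := by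
  rw [upperPart_apply]
  refine ⟨fun k hk => ?_, fun k hk => ?_, ?_⟩
  · simp [co_posPart, co_mono, hk, hk.ne']
  · simp [co_posPart, co_mono, hk, hk.ne']
  · have hsum : ∑ n, (co 0 (D * Ξ) - shift m (co 0 (Ξ * D))) n = 0 := by
      simp only [Pi.sub_apply, Finset.sum_sub_distrib]
      rw [sum_shift, ← opTrace_apply, ← opTrace_apply, opTrace_mul_comm, sub_self]
    have h := solveShift_sub_shift hm hsum
    simp only [Prod.fst_sub, Prod.snd_sub, map_sub, map_add, co_posPart, co_mono, lt_irrefl,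
      if_false, if_true, zero_add]
    change co 0 (D * Ξ) - solveShift N m _ = _ - shift m (solveShift N m _)
    linear_combination -h

/-- The quadratic vector field `Y D' - D' X`, where `(Y, X)` is the upper part of `(D Ξ, Ξ D)`. -/
def quadField (m : ℤ) (D D' Ξ : DiffOp N) : DiffOp N :=
  (upperPart m D Ξ).1 * D' - D' * (upperPart m D Ξ).2

end ManinPair

/-! ### The Hamiltonian operator in the coordinates a -/

section HamiltonianField

variable {d N : ℕ}

/-- The operator `-∑ᵣ aʳ Tʳ`. -/
def invariantsOp : Invariants d N →ₗ[ℝ] DiffOp N where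
  toFun a := -∑ r : Fin d, mono (r + 1) fun n => a n r
  map_add' a b := by
    rw [← neg_add, ← Finset.sum_add_distrib]
    refine congrArg Neg.neg (Finset.sum_congr rfl fun r _ => ?_)
    rw [← map_add]
    rfl
  map_smul' c a := by
    rw [RingHom.id_apply, smul_neg, Finset.smul_sum]
    refine congrArg Neg.neg (Finset.sum_congr rfl fun r _ => ?_)
    rw [← map_smul]
    rfl

/-- The invariants read off from an operator `-∑ᵣ aʳ Tʳ`. -/
def readInvariants : DiffOp N →ₗ[ℝ] Invariants d N where
  toFun x := fun n r => -co (r + 1) x n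
  map_add' x y := by
    funext n r
    simp only [map_add, Pi.add_apply, neg_add]
  map_smul' c x := by
    funext n r
    simp

theorem readInvariants_apply (x : DiffOp N) (n : ZMod N) (r : Fin d) :
    readInvariants x n r = -co (r + 1) x n := rfl

theorem co_invariantsOp (k : ℤ) (a : Invariants d N) :
    co k (invariantsOp a) = -∑ r : Fin d, if k = r + 1 then fun n => a n r else 0 := by
  change co k (-∑ r : Fin d, mono (r + 1) fun n => a n r) = _
  rw [map_neg, map_sum]
  simp only [co_mono]

theorem co_invariantsOp_fin (r : Fin d) (a : Invariants d N) :
    co (r + 1) (invariantsOp a) = fun n => -a n r := by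
  rw [co_invariantsOp, Finset.sum_eq_single r]
  · simp only [if_true]; rfl
  · intro s _ hs
    rw [if_neg]
    intro h
    exact hs (Fin.ext (by omega))
  · simp

theorem co_invariantsOp_of_nonpos {k : ℤ} (hk : k ≤ 0) (a : Invariants d N) :
    co k (invariantsOp a) = 0 := by
  rw [co_invariantsOp, Finset.sum_eq_zero, neg_zero]
  intro r _
  rw [if_neg (by omega)]

theorem co_invariantsOp_of_gt {k : ℤ} (hk : d < k) (a : Invariants d N) :
    co k (invariantsOp a) = 0 := by
  rw [co_invariantsOp, Finset.sum_eq_zero, neg_zero]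
  intro r _
  rw [if_neg (by omega)]

theorem invariantsOp_readInvariants {x : DiffOp N} (h₀ : ∀ k ≤ 0, co k x = 0)
    (h₁ : ∀ k : ℤ, d < k → co k x = 0) :
    invariantsOp (readInvariants x : Invariants d N) = x := by
  refine diffOp_ext fun k => ?_
  rcases le_or_gt k 0 with hk | hk
  · rw [co_invariantsOp_of_nonpos hk, h₀ k hk]
  rcases lt_or_ge (d : ℤ) k with hk' | hk'
  · rw [co_invariantsOp_of_gt hk', h₁ k hk']
  obtain ⟨r, rfl⟩ : ∃ r : Fin d, k = r + 1 :=
    ⟨⟨(k - 1).toNat, by omega⟩, by simp only; omega⟩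
  rw [co_invariantsOp_fin]
  funext n
  rw [readInvariants_apply, neg_neg]

/-- The operator `Tᵐ - ∑ᵣ aʳ Tʳ + e` with `m = d + 1`. -/
def laxOp (e : ℝ) (a : Invariants d N) : DiffOp N :=
  mono (d + 1) 1 + mono 0 (fun _ => e) + invariantsOp a

theorem co_laxOp_of_neg (e : ℝ) (a : Invariants d N) {k : ℤ} (hk : k < 0) :
    co k (laxOp e a) = 0 := by
  simp [laxOp, co_mono, hk.ne, co_invariantsOp_of_nonpos hk.le,
    show ¬ k = (d : ℤ) + 1 by omega]

theorem co_laxOp_of_gt (e : ℝ) (a : Invariants d N) {k : ℤ} (hk : (d : ℤ) + 1 < k) :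
    co k (laxOp e a) = 0 := by
  simp [laxOp, co_mono, hk.ne', co_invariantsOp_of_gt (show (d : ℤ) < k by omega),
    show ¬ k = 0 by omega]

theorem co_laxOp_top (e : ℝ) (a : Invariants d N) : co (d + 1) (laxOp e a) = 1 := by
  simp [laxOp, co_mono, co_invariantsOp_of_gt (show (d : ℤ) < d + 1 by omega),
    show ¬ (d : ℤ) + 1 = 0 by omega]

theorem co_laxOp_fin (e : ℝ) (a : Invariants d N) (r : Fin d) :
    co (r + 1) (laxOp e a) = fun n => -a n r := by
  simp [laxOp, co_mono, co_invariantsOp_fin, show ¬ (r : ℤ) + 1 = 0 by omega, r.2.ne]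

/-- A covector as the operator `∑ᵣ T⁻ʳ ξᵣ`. -/
def covectorOp : (Invariants d N →L[ℝ] ℝ) →ₗ[ℝ] DiffOp N where
  toFun ξ := ∑ r : Fin d, mono (-(r + 1))
    (shift (-(r + 1)) fun n => ξ (Pi.single n (Pi.single r 1)))
  map_add' ξ η := by
    rw [← Finset.sum_add_distrib]
    refine Finset.sum_congr rfl fun r _ => ?_
    rw [← map_add, ← map_add]
    rfl
  map_smul' c ξ := by
    rw [RingHom.id_apply, Finset.smul_sum]
    refine Finset.sum_congr rfl fun r _ => ?_
    rw [← map_smul, ← map_smul]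
    rfl

theorem covectorOp_apply (ξ : Invariants d N →L[ℝ] ℝ) :
    covectorOp ξ = ∑ r : Fin d, mono (-(r + 1))
      (shift (-(r + 1)) fun n => ξ (Pi.single n (Pi.single r 1))) := rfl

theorem co_covectorOp_of_nonneg (ξ : Invariants d N →L[ℝ] ℝ) {k : ℤ} (hk : 0 ≤ k) :
    co k (covectorOp ξ) = 0 := by
  rw [covectorOp_apply, map_sum]
  refine Finset.sum_eq_zero fun r _ => ?_
  rw [co_mono, if_neg (by omega)]

/-- The homogeneous linear version of `laxOp`. -/
def laxLinear (e : ℝ) : ℝ × Invariants d N →ₗ[ℝ] DiffOp N :=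
  (LinearMap.toSpanSingleton ℝ (DiffOp N) (mono (d + 1) 1 + mono 0 fun _ => e)).coprod invariantsOp

theorem laxLinear_apply (e s : ℝ) (a : Invariants d N) :
    laxLinear e (s, a) = s • (mono (d + 1) 1 + mono 0 fun _ => e) + invariantsOp a := by
  simp [laxLinear]

theorem laxLinear_one (e : ℝ) (a : Invariants d N) : laxLinear e (1, a) = laxOp e a := by
  rw [laxLinear_apply, one_smul]; rfl

theorem laxLinear_zero (e : ℝ) (a : Invariants d N) : laxLinear e (0, a) = invariantsOp a := by
  rw [laxLinear, LinearMap.coprod_apply, map_zero, zero_add]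

variable [NeZero N]

theorem covector_apply (ξ : Invariants d N →L[ℝ] ℝ) (v : Invariants d N) :
    ξ v = ∑ n, ∑ r, ξ (Pi.single n (Pi.single r 1)) * v n r := by
  have hv : v = ∑ n, ∑ r, v n r • (Pi.single n (Pi.single r (1 : ℝ)) : Invariants d N) := by
    funext n r
    simp [Finset.sum_apply, Pi.single_apply, apply_ite, ite_apply]
  conv_lhs => rw [hv]
  simp [map_sum, mul_comm]

/-- The trace pairing picks, for each power T⁻ʳ in the covector operator, the coefficient of Tʳ; the
shift in `covectorOp` aligns the indices. The sign reflects that the invariants enter D with a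
minus. -/
theorem opTrace_covectorOp_mul (ξ : Invariants d N →L[ℝ] ℝ) (x : DiffOp N) :
    opTrace (covectorOp ξ * x) = -ξ (readInvariants x) := by
  rw [covector_apply, covectorOp_apply, Finset.sum_mul, map_sum, Finset.sum_comm,
    ← Finset.sum_neg_distrib]
  refine Finset.sum_congr rfl fun r _ => ?_
  rw [opTrace_mono_mul, neg_neg, ← Finset.sum_neg_distrib]
  conv_rhs => rw [← sum_shift (-((r : ℤ) + 1))]
  refine Finset.sum_congr rfl fun n _ => ?_
  simp only [readInvariants_apply, shift_apply]
  ring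

/-- The polarization of the Hamiltonian operator. -/
def hamiltonianBilin (e : ℝ) : (ℝ × Invariants d N) →ₗ[ℝ] (ℝ × Invariants d N) →ₗ[ℝ]
    ((Invariants d N →L[ℝ] ℝ) →L[ℝ] Invariants d N) :=
  LinearMap.mk₂ ℝ (fun p q => LinearMap.toContinuousLinearMap
      { toFun := fun ξ => readInvariants
          (quadField (d + 1) (laxLinear e p) (laxLinear e q) (covectorOp ξ))
        map_add' := fun ξ η => by
          rw [← map_add]
          refine congrArg _ ?_
          simp only [quadField, map_add, Prod.fst_add, Prod.snd_add, add_mul, mul_add]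
          abel
        map_smul' := fun c ξ => by
          rw [← map_smul]
          refine congrArg _ ?_
          simp only [quadField, map_smul, Prod.smul_fst, Prod.smul_snd, smul_mul_assoc,
            mul_smul_comm, smul_sub, RingHom.id_apply] })
    (fun p p' q => by
      ext1 ξ
      change readInvariants _ = readInvariants _ + readInvariants _
      rw [← map_add]
      refine congrArg _ ?_
      simp only [quadField, map_add, LinearMap.add_apply, Prod.fst_add, Prod.snd_add, add_mul,
        mul_add]
      abel)
    (fun c p q => by
      ext1 ξ
      change readInvariants _ = c • readInvariants _
      rw [← map_smul]
      refine congrArg _ ?_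
      simp only [quadField, map_smul, LinearMap.smul_apply, Prod.smul_fst, Prod.smul_snd,
        smul_mul_assoc, mul_smul_comm, smul_sub])
    (fun p q q' => by
      ext1 ξ
      change readInvariants _ = readInvariants _ + readInvariants _
      rw [← map_add]
      refine congrArg _ ?_
      simp only [quadField, map_add, add_mul, mul_add]
      abel)
    (fun c p q => by
      ext1 ξ
      change readInvariants _ = c • readInvariants _
      rw [← map_smul]
      refine congrArg _ ?_
      simp only [quadField, map_smul, smul_mul_assoc, mul_smul_comm, smul_sub])

theorem hamiltonianBilin_apply (e : ℝ) (p q : ℝ × Invariants d N)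
    (ξ : Invariants d N →L[ℝ] ℝ) :
    hamiltonianBilin e p q ξ =
      readInvariants (quadField (d + 1) (laxLinear e p) (laxLinear e q) (covectorOp ξ)) := rfl

/-- The Hamiltonian operator of the quadratic bracket on operators `Tᵐ - ∑ᵣ aʳ Tʳ + e`. -/
def hamiltonian (e : ℝ) (a : Invariants d N) : (Invariants d N →L[ℝ] ℝ) →L[ℝ] Invariants d N :=
  hamiltonianBilin e (1, a) (1, a)

theorem hamiltonian_apply (e : ℝ) (a : Invariants d N) (ξ : Invariants d N →L[ℝ] ℝ) :
    hamiltonian e a ξ =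
      readInvariants (quadField (d + 1) (laxOp e a) (laxOp e a) (covectorOp ξ)) := by
  rw [hamiltonian, hamiltonianBilin_apply, laxLinear_one]

/-- A bilinear map between finite-dimensional spaces as a continuous bilinear map. -/
def continuousBilin {E F : Type*} [NormedAddCommGroup E] [NormedSpace ℝ E] [FiniteDimensional ℝ E]
    [NormedAddCommGroup F] [NormedSpace ℝ F] (b : E →ₗ[ℝ] E →ₗ[ℝ] F) : E →L[ℝ] E →L[ℝ] F :=
  LinearMap.toContinuousLinearMap
    ((LinearMap.toContinuousLinearMap : (E →ₗ[ℝ] F) ≃ₗ[ℝ] (E →L[ℝ] F)).toLinearMap ∘ₗ b)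

theorem contDiff_continuousBilin_diag {E F : Type*} [NormedAddCommGroup E] [NormedSpace ℝ E]
    [FiniteDimensional ℝ E] [NormedAddCommGroup F] [NormedSpace ℝ F]
    (b : (ℝ × E) →ₗ[ℝ] (ℝ × E) →ₗ[ℝ] F) : ContDiff ℝ ∞ fun a : E => b (1, a) (1, a) := by
  have h₁ : ContDiff ℝ ∞ fun a : E => ((1 : ℝ), a) := contDiff_const.prodMk contDiff_id
  exact ((continuousBilin b).contDiff.comp h₁).clm_apply h₁

theorem fderiv_continuousBilin_diag {E F : Type*} [NormedAddCommGroup E] [NormedSpace ℝ E]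
    [FiniteDimensional ℝ E] [NormedAddCommGroup F] [NormedSpace ℝ F]
    (b : (ℝ × E) →ₗ[ℝ] (ℝ × E) →ₗ[ℝ] F) (a v : E) :
    fderiv ℝ (fun a : E => b (1, a) (1, a)) a v = b (0, v) (1, a) + b (1, a) (0, v) := by
  have h₁ : HasFDerivAt (fun a : E => ((1 : ℝ), a)) (ContinuousLinearMap.inr ℝ ℝ E) a :=
    (hasFDerivAt_const (1 : ℝ) a).prodMk (hasFDerivAt_id a)
  have h₂ : HasFDerivAt (fun a : E => b (1, a) (1, a)) _ a :=
    ((continuousBilin b).hasFDerivAt.comp a h₁).clm_apply h₁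
  rw [h₂.fderiv, add_comm]
  rfl

theorem contDiff_hamiltonian_field (e : ℝ) :
    ContDiff ℝ ∞ (hamiltonian (d := d) (N := N) e) :=
  contDiff_continuousBilin_diag (E := Invariants d N)
    (F := (Invariants d N →L[ℝ] ℝ) →L[ℝ] Invariants d N) (hamiltonianBilin e)

theorem fderiv_hamiltonian_field (e : ℝ) (a v : Invariants d N) (ξ : Invariants d N →L[ℝ] ℝ) :
    fderiv ℝ (hamiltonian e) a v ξ =
      readInvariants (quadField (d + 1) (invariantsOp v) (laxOp e a) (covectorOp ξ)
        + quadField (d + 1) (laxOp e a) (invariantsOp v) (covectorOp ξ)) := by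
  have h := fderiv_continuousBilin_diag (E := Invariants d N)
    (F := (Invariants d N →L[ℝ] ℝ) →L[ℝ] Invariants d N) (hamiltonianBilin e) a v
  rw [show hamiltonian e = fun a : Invariants d N => hamiltonianBilin e (1, a) (1, a) from rfl, h,
    map_add, ← laxLinear_zero e v, ← laxLinear_one]
  rfl

end HamiltonianField

/-! ### Tangency, Jacobi identity and dependence on the constant term -/

section PoissonPencil

variable {d N : ℕ}

/-- Lower half of the tangency: Y, X and D have no negative degrees, and the constant terms of YD
and DX agree because those of Y and X do. -/
theorem co_quadField_of_nonpos (e : ℝ) (a : Invariants d N) (Ξ : DiffOp N) {k : ℤ} (hk : k ≤ 0) :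
    co k (quadField (d + 1) (laxOp e a) (laxOp e a) Ξ) = 0 := by
  obtain ⟨hY, hX, h₀⟩ := upperPair_upperPart (d + 1) (laxOp e a) Ξ
  obtain ⟨h₁, h₁'⟩ := co_mul_of_le hY fun k => co_laxOp_of_neg e a
  obtain ⟨h₂, h₂'⟩ := co_mul_of_le (fun k => co_laxOp_of_neg e a) hX
  rw [add_zero] at h₁ h₁' h₂ h₂'
  rw [quadField, map_sub]
  rcases hk.lt_or_eq with hk | rfl
  · rw [h₁ k hk, h₂ k hk, sub_zero]
  · rw [h₁', h₂', shift_zero, shift_zero, h₀, mul_comm, sub_self]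

/-- Covector operators have only negative degrees. Hence the constant term e of D is invisible to
the upper part, which makes the Hamiltonian operator affine in e. -/
theorem upperPart_one_covectorOp (m : ℤ) (ξ : Invariants d N →L[ℝ] ℝ) :
    upperPart m 1 (covectorOp ξ) = 0 := by
  have h₀ : posPart (covectorOp ξ) = 0 := by
    refine diffOp_ext fun k => ?_
    rw [co_posPart, map_zero]
    split_ifs with h
    · exact co_covectorOp_of_nonneg ξ h.le
    · rfl
  rw [upperPart_apply, gaugeCoeff, one_mul, mul_one, h₀, co_covectorOp_of_nonneg ξ le_rfl]
  simp

variable [NeZero N]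

theorem lowerPair_sub_upperPart' (hcop : Nat.Coprime N (d + 1)) (D Ξ : DiffOp N) :
    LowerPair (d + 1) ((D * Ξ, Ξ * D) - upperPart (d + 1) D Ξ) := by
  have h := lowerPair_sub_upperPart hcop D Ξ
  rw [Nat.cast_succ] at h
  exact h

/-- Upper half of the tangency: as D(ΞD) = (DΞ)D, the field YD - DX can be rewritten with the
complementary lower pair. Its degree is then at most m, and the coefficients of Tᵐ cancel by the
intertwining condition in `LowerPair`. -/
theorem co_quadField_of_gt (hcop : Nat.Coprime N (d + 1)) (e : ℝ)
    (a : Invariants d N) (Ξ : DiffOp N) {k : ℤ} (hk : d < k) :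
    co k (quadField (d + 1) (laxOp e a) (laxOp e a) Ξ) = 0 := by
  obtain ⟨hY, hX, h₀⟩ := lowerPair_sub_upperPart' hcop (laxOp e a) Ξ
  obtain ⟨h₁, h₁'⟩ := co_mul_of_ge hY fun k => co_laxOp_of_gt e a
  obtain ⟨h₂, h₂'⟩ := co_mul_of_ge (fun k => co_laxOp_of_gt e a) hX
  have hq : quadField (d + 1) (laxOp e a) (laxOp e a) Ξ =
      laxOp e a * ((laxOp e a * Ξ, Ξ * laxOp e a) - upperPart (d + 1) (laxOp e a) Ξ).2
      - ((laxOp e a * Ξ, Ξ * laxOp e a) - upperPart (d + 1) (laxOp e a) Ξ).1 * laxOp e a := by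
    simp only [quadField, Prod.fst_sub, Prod.snd_sub, sub_mul, mul_sub, mul_assoc]
    abel
  rw [zero_add] at h₁ h₁'
  rw [add_zero] at h₂ h₂'
  rw [hq, map_sub]
  rcases (show (d : ℤ) + 1 ≤ k by omega).lt_or_eq with hk | rfl
  · rw [h₁ k hk, h₂ k hk, sub_zero]
  · rw [h₁', h₂', co_laxOp_top, h₀, one_mul, show shift 0 (1 : ZMod N → ℝ) = 1 from rfl, mul_one,
      sub_self]

theorem invariantsOp_hamiltonian (hcop : Nat.Coprime N (d + 1)) (e : ℝ)
    (a : Invariants d N) (ξ : Invariants d N →L[ℝ] ℝ) :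
    invariantsOp (hamiltonian e a ξ) =
      quadField (d + 1) (laxOp e a) (laxOp e a) (covectorOp ξ) := by
  rw [hamiltonian_apply]
  exact invariantsOp_readInvariants (fun k => co_quadField_of_nonpos e a _)
    fun k => co_quadField_of_gt hcop e a _

theorem hamiltonian_skew (hcop : Nat.Coprime N (d + 1)) (e : ℝ)
    (a : Invariants d N) (ξ η : Invariants d N →L[ℝ] ℝ) :
    ξ (hamiltonian e a η) = -η (hamiltonian e a ξ) := by
  have h := (isManinPair (N := N) (d + 1)).skew
    (upperPair_upperPart (d + 1) (laxOp e a) (covectorOp ξ))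
    (upperPair_upperPart (d + 1) (laxOp e a) (covectorOp η))
    (lowerPair_sub_upperPart' hcop (laxOp e a) (covectorOp ξ))
    (lowerPair_sub_upperPart' hcop (laxOp e a) (covectorOp η))
  rw [hamiltonian_apply, hamiltonian_apply, ← neg_inj, ← opTrace_covectorOp_mul,
    ← opTrace_covectorOp_mul]
  exact h

/-- The upper part is bilinear in (D, Ξ), so its derivative along δ is the upper part of (δΞ, Ξδ).
By tangency δ may be taken to be the quadratic field itself, and the algebraic Jacobi identity
applies. -/
theorem hamiltonian_jacobi (hcop : Nat.Coprime N (d + 1)) (e : ℝ)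
    (a : Invariants d N) (ξ η ζ : Invariants d N →L[ℝ] ℝ) :
    ξ (fderiv ℝ (hamiltonian e) a (hamiltonian e a ζ) η)
      + η (fderiv ℝ (hamiltonian e) a (hamiltonian e a ξ) ζ)
      + ζ (fderiv ℝ (hamiltonian e) a (hamiltonian e a η) ξ) = 0 := by
  have h := (isManinPair (N := N) (d + 1)).jacobi
    (upperPair_upperPart (d + 1) (laxOp e a) (covectorOp ξ))
    (upperPair_upperPart (d + 1) (laxOp e a) (covectorOp η))
    (upperPair_upperPart (d + 1) (laxOp e a) (covectorOp ζ))
    (lowerPair_sub_upperPart' hcop (laxOp e a) (covectorOp ξ))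
    (lowerPair_sub_upperPart' hcop (laxOp e a) (covectorOp η))
    (lowerPair_sub_upperPart' hcop (laxOp e a) (covectorOp ζ))
    (upperPair_upperPart (d + 1) _ (covectorOp η)) (upperPair_upperPart (d + 1) _ (covectorOp ζ))
    (upperPair_upperPart (d + 1) _ (covectorOp ξ)) (lowerPair_sub_upperPart' hcop _ _)
    (lowerPair_sub_upperPart' hcop _ _) (lowerPair_sub_upperPart' hcop _ _)
  simp only [fderiv_hamiltonian_field, invariantsOp_hamiltonian hcop]
  simp only [← neg_eq_iff_eq_neg.2 (opTrace_covectorOp_mul _ _)]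
  simp only [add_sub_assoc] at h
  rw [← neg_add, ← neg_add, neg_eq_zero]
  exact h

/-- As (Y, X) does not depend on e, the change in YD - DX is e(Y - X). The constant terms of Y and X
cancel there, leaving the positive part of [D, Ξ], which is all that `readInvariants` sees. -/
theorem hamiltonian_eq_add_smul (e : ℝ) (a : Invariants d N) (ξ : Invariants d N →L[ℝ] ℝ) :
    hamiltonian e a ξ = hamiltonian 0 a ξ
      + e • readInvariants (laxOp 0 a * covectorOp ξ - covectorOp ξ * laxOp 0 a) := by
  have hD : laxOp e a = laxOp 0 a + e • (1 : DiffOp N) := by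
    rw [laxOp, laxOp, ← mono_zero_one, ← map_smul]
    have h₁ : (fun _ : ZMod N => e) = e • (1 : ZMod N → ℝ) := by funext; simp
    have h₂ : mono 0 (fun _ : ZMod N => (0 : ℝ)) = 0 := map_zero (mono 0)
    rw [h₁, h₂]
    abel
  have hU : upperPart (d + 1) (laxOp e a) (covectorOp ξ) =
      upperPart (d + 1) (laxOp 0 a) (covectorOp ξ) := by
    rw [hD, map_add, map_smul, LinearMap.add_apply, LinearMap.smul_apply,
      upperPart_one_covectorOp, smul_zero, add_zero]
  have hP : ∀ x : DiffOp N, (readInvariants (posPart x) : Invariants d N) = readInvariants x := by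
    intro x
    funext n r
    rw [readInvariants_apply, readInvariants_apply, co_posPart, if_pos (by omega)]
  rw [hamiltonian_apply, hamiltonian_apply, map_sub, ← hP (laxOp 0 a * _), ← hP (_ * laxOp 0 a),
    ← map_sub, ← map_smul, ← map_add]
  refine congrArg _ ?_
  rw [quadField, quadField, hU, hD, mul_add, add_mul, mul_smul_comm, smul_mul_assoc, mul_one,
    one_mul, smul_sub, upperPart_apply]
  simp only [smul_add]
  abel

/-- The derivative of the Hamiltonian operator with respect to the constant term. -/
def linearHamiltonian (a : Invariants d N) : (Invariants d N →L[ℝ] ℝ) →L[ℝ] Invariants d N :=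
  hamiltonian 1 a - hamiltonian 0 a

theorem linearHamiltonian_apply (a : Invariants d N) (ξ : Invariants d N →L[ℝ] ℝ) :
    linearHamiltonian a ξ =
      readInvariants (laxOp 0 a * covectorOp ξ - covectorOp ξ * laxOp 0 a) := by
  rw [linearHamiltonian, sub_apply, hamiltonian_eq_add_smul 1, one_smul, add_sub_cancel_left]

theorem hamiltonian_eq (e : ℝ) :
    (hamiltonian e : Invariants d N → _) = hamiltonian 0 + e • linearHamiltonian := by
  funext a
  ext1 ξ
  rw [hamiltonian_eq_add_smul, ← linearHamiltonian_apply]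
  rfl

theorem contDiff_linearHamiltonian : ContDiff ℝ ∞ (linearHamiltonian (d := d) (N := N)) :=
  (contDiff_hamiltonian_field 1).sub (contDiff_hamiltonian_field 0)

/-- All linear combinations of the quadratic and the linear bracket are Poisson brackets. -/
theorem isPoissonBracket_pencil (hcop : Nat.Coprime N (d + 1)) (s t : ℝ)
    (B : (Invariants d N → ℝ) → (Invariants d N → ℝ) → (Invariants d N → ℝ))
    (hB : ∀ f g, ContDiff ℝ ∞ f → ContDiff ℝ ∞ g → B f g = fun a =>
      s * fderiv ℝ f a (hamiltonian 0 a (fderiv ℝ g a))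
      + t * fderiv ℝ f a (linearHamiltonian a (fderiv ℝ g a))) :
    IsPoissonBracket B := by
  refine isPoissonBracket_of_hamiltonian
    (s • (hamiltonian 0 : Invariants d N → _) + t • linearHamiltonian)
    (((contDiff_hamiltonian_field (d := d) (N := N) 0).const_smul s).add
      ((contDiff_linearHamiltonian (d := d) (N := N)).const_smul t))
    (fun a ξ η => ?_) (jacobiator_pencil _ _ (contDiff_hamiltonian_field (d := d) (N := N) 0)
      (contDiff_linearHamiltonian (d := d) (N := N)) (fun e a ξ η ζ => ?_) s t) B
    fun f g hf hg => ?_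
  · have h₀ := hamiltonian_skew hcop 0 a ξ η
    have h₁ := hamiltonian_skew hcop 1 a ξ η
    simp only [linearHamiltonian, Pi.add_apply, Pi.smul_apply, add_apply, smul_apply, sub_apply,
      map_add, map_sub, map_smul, smul_eq_mul]
    linear_combination (s - t) * h₀ + t * h₁
  · rw [← hamiltonian_eq]
    exact hamiltonian_jacobi hcop e a ξ η ζ
  · rw [hB f g hf hg]
    funext a
    simp only [Pi.add_apply, Pi.smul_apply, add_apply, smul_apply, map_add, map_smul, smul_eq_mul]

end PoissonPencil

/-! ### The gauge action and the section -/

section GaugeAction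

variable {d N : ℕ}

theorem frameMatrix_castSucc_zero (a : Fin d → ℝ) (r : Fin d) :
    frameMatrix a r.castSucc 0 = (-1) ^ (d + 1) * a r := by
  simp [frameMatrix]

theorem frameMatrix_last_zero (a : Fin d → ℝ) : frameMatrix a (Fin.last d) 0 = (-1) ^ d := by
  simp [frameMatrix]

theorem frameMatrix_succ (a : Fin d → ℝ) (i : Fin (d + 1)) (r : Fin d) :
    frameMatrix a i r.succ = if i = r.castSucc then 1 else 0 := by
  simp [frameMatrix]

theorem frameMatrix_mulVec_single_succ (a : Fin d → ℝ) (r : Fin d) :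
    (frameMatrix a).mulVec (Pi.single r.succ 1) = Pi.single r.castSucc 1 := by
  ext i
  rw [Matrix.mulVec_single_one, Matrix.col_apply, frameMatrix_succ, Pi.single_apply]

theorem det_eq_of_frame_columns {M : Matrix (Fin (d + 1)) (Fin (d + 1)) ℝ}
    (hM : ∀ i (r : Fin d), M i r.succ = if i = r.castSucc then 1 else 0) :
    M.det = (-1) ^ d * M (Fin.last d) 0 := by
  rw [Matrix.det_succ_row _ (Fin.last d), Fin.sum_univ_succ]
  have hsub : M.submatrix (Fin.last d).succAbove (Fin.succAbove 0) = 1 := by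
    ext i j
    simp [hM, Matrix.one_apply]
  have hz : ∀ r : Fin d, M (Fin.last d) r.succ = 0 := by
    intro r
    rw [hM, if_neg (Fin.castSucc_lt_last r).ne']
  rw [hsub]
  simp [hz]

/-- Once the other columns are fixed, the determinant is ± the bottom entry of the first column, so
that entry is forced. -/
theorem eq_frameMatrix {M : Matrix (Fin (d + 1)) (Fin (d + 1)) ℝ} (hdet : M.det = 1)
    (hM : ∀ i (r : Fin d), M i r.succ = if i = r.castSucc then 1 else 0) :
    frameMatrix (fun r => (-1) ^ (d + 1) * M r.castSucc 0) = M := by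
  have hs : ∀ k : ℕ, ((-1 : ℝ) ^ k) * (-1) ^ k = 1 := fun k => by rw [← mul_pow]; simp
  ext i j
  refine Fin.cases ?_ (fun r => ?_) j
  · refine Fin.lastCases ?_ (fun r => ?_) i
    · rw [det_eq_of_frame_columns hM] at hdet
      rw [frameMatrix_last_zero]
      calc (-1 : ℝ) ^ d = (-1) ^ d * ((-1) ^ d * M (Fin.last d) 0) := by rw [hdet, mul_one]
        _ = M (Fin.last d) 0 := by rw [← mul_assoc, hs, one_mul]
    · rw [frameMatrix_castSucc_zero, ← mul_assoc, hs, one_mul]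
  · rw [frameMatrix_succ, hM]

theorem gauge_mul (h h' : ZMod N → parabolic d) (L : ZMod N → Grp d) :
    gauge (h * h') L = gauge h (gauge h' L) := by
  funext n
  simp only [gauge, Pi.mul_apply, Subgroup.coe_mul, mul_inv_rev, mul_assoc]

theorem gauge_one (L : ZMod N → Grp d) : gauge 1 L = L := by
  funext n
  simp [gauge]

theorem coe_gauge_mul (h : ZMod N → parabolic d) (L : ZMod N → Grp d) (n : ZMod N) :
    (gauge h L n).1 * (h n : Grp d).1 = (h (n + 1) : Grp d).1 * (L n).1 :=
  congrArg Subtype.val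
    (show gauge h L n * (h n : Grp d) = h (n + 1) * L n by simp [gauge])

theorem parabolic_mulVec_single_zero (h : parabolic d) :
    (h : Grp d).1.mulVec (Pi.single 0 1) = (h : Grp d).1 0 0 • Pi.single 0 1 := by
  ext i
  rw [Matrix.mulVec_single_one, Matrix.col_apply]
  by_cases hi : i = 0
  · simp [hi]
  · simp [hi, h.2 i hi]

theorem parabolic_zero_zero_ne_zero (h : parabolic d) : (h : Grp d).1 0 0 ≠ 0 := by
  intro h0
  have h1 := parabolic_mulVec_single_zero h
  rw [h0, zero_smul] at h1
  have h2 := congrArg (fun v => (h : Grp d).1.adjugate.mulVec v) h1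
  simp only [Matrix.mulVec_mulVec, Matrix.adjugate_mul, (h : Grp d).2, one_smul, Matrix.one_mulVec,
    Matrix.mulVec_zero] at h2
  simpa using congrFun h2 0

/-- The vectors `M_n⁻¹ ⋯ M_{n+j-1}⁻¹ e₁`. -/
def transport (M : ZMod N → Matrix (Fin (d + 1)) (Fin (d + 1)) ℝ) : ℕ → ZMod N → Fin (d + 1) → ℝ
  | 0, _ => Pi.single 0 1
  | j + 1, n => (M n).adjugate.mulVec (transport M j (n + 1))

/-- The frame formed by the first `m` transported vectors. -/
def transportFrame (M : ZMod N → Matrix (Fin (d + 1)) (Fin (d + 1)) ℝ) (n : ZMod N) :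
    Matrix (Fin (d + 1)) (Fin (d + 1)) ℝ :=
  Matrix.of fun i j => transport M j n i

/-- Writing M for the gauge transform, Mₙhₙ = hₙ₊₁L(aₙ), and L(aₙ) sends each basis vector but the
first to its predecessor; so Mₙ⁻¹ carries column j of hₙ₊₁ to column j + 1 of hₙ. The start is that
e₁ is an eigenvector of h. Since det M = 1, the adjugate serves as a polynomial inverse. -/
theorem transport_gauge (h : ZMod N → parabolic d) (a : Invariants d N) (j : ℕ) (hj : j < d + 1)
    (n : ZMod N) :
    (h (n + j) : Grp d).1 0 0 • transport (fun n => (gauge h (frameSection a) n).1) j n =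
      (h n : Grp d).1.mulVec (Pi.single ⟨j, hj⟩ 1) := by
  induction j generalizing n with
  | zero =>
    rw [Nat.cast_zero, add_zero]
    exact (parabolic_mulVec_single_zero (h n)).symm
  | succ j ih =>
    have hj' : j < d := by omega
    have h₁ := ih (by omega) (n + 1)
    have h₃ := frameMatrix_mulVec_single_succ (a n) ⟨j, hj'⟩
    rw [transport, Nat.cast_succ, add_comm (j : ZMod N) 1, ← add_assoc, ← Matrix.mulVec_smul, h₁]
    have h₄ : (Pi.single ⟨j, by omega⟩ 1 : Fin (d + 1) → ℝ) = Pi.single (Fin.castSucc ⟨j, hj'⟩) 1 :=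
      rfl
    have h₂ : (h (n + 1) : Grp d).1.mulVec ((frameMatrix (a n)).mulVec
        (Pi.single (Fin.succ ⟨j, hj'⟩) 1)) = (gauge h (frameSection a) n).1.mulVec
          ((h n : Grp d).1.mulVec (Pi.single (Fin.succ ⟨j, hj'⟩) 1)) := by
      rw [Matrix.mulVec_mulVec, Matrix.mulVec_mulVec, coe_gauge_mul]
      rfl
    rw [h₄, ← h₃, h₂, Matrix.mulVec_mulVec, Matrix.adjugate_mul,
      show (gauge h (frameSection a) n).1.det = 1 from (gauge h (frameSection a) n).2, one_smul,
      Matrix.one_mulVec]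
    rfl

theorem transportFrame_gauge (h : ZMod N → parabolic d) (a : Invariants d N) (n : ZMod N) :
    transportFrame (fun n => (gauge h (frameSection a) n).1) n *
      Matrix.diagonal (fun j : Fin (d + 1) => (h (n + (j : ℕ)) : Grp d).1 0 0) =
        (h n : Grp d).1 := by
  ext i j
  have := congrFun (transport_gauge h a j j.2 n) i
  rw [Matrix.mulVec_single_one, Matrix.col_apply] at this
  rw [Matrix.mul_diagonal, mul_comm]
  exact this

theorem transportFrame_frameSection (a : Invariants d N) (n : ZMod N) :
    transportFrame (fun n => (frameSection a n).1) n = 1 := by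
  have h := transportFrame_gauge (1 : ZMod N → parabolic d) a n
  rw [gauge_one] at h
  simpa using h

theorem eq_of_add_eq {m : ℕ} [NeZero N] (hcop : Nat.Coprime N m) {α : Type*} {x : ZMod N → α}
    (hx : ∀ n, x (n + m) = x n) (n : ZMod N) : x n = x 0 := by
  have h₁ : ∀ k : ℕ, x ((k : ZMod N) * m) = x 0 := by
    intro k
    induction k with
    | zero => simp
    | succ k ih => rw [← ih, ← hx (k * m)]; congr 1; push_cast; ring
  obtain ⟨u, hu⟩ := (ZMod.isUnit_iff_coprime m N).2 hcop.symm
  have h₂ := h₁ (n * ↑u⁻¹ : ZMod N).val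
  rwa [ZMod.natCast_zmod_val, ← hu, mul_assoc, Units.inv_mul, mul_one] at h₂

/-- Between two points of the section the transported frame is the identity, so h is diagonal with
entries λₙ, …, λₙ₊ₘ₋₁ of product 1. Comparing consecutive windows gives λₙ₊ₘ = λₙ; by coprimality λ
is constant, so h is the same scalar matrix at every index and acts trivially. -/
theorem eq_of_gauge_eq [NeZero N] (hcop : Nat.Coprime N (d + 1)) {h : ZMod N → parabolic d}
    {a a' : Invariants d N} (hh : gauge h (frameSection a) = frameSection a') : a = a' := by
  have h₁ : ∀ n, Matrix.diagonal (fun j : Fin (d + 1) => (h (n + (j : ℕ)) : Grp d).1 0 0) =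
      (h n : Grp d).1 := by
    intro n
    have := transportFrame_gauge h a n
    rwa [hh, transportFrame_frameSection, one_mul] at this
  have h₂ : ∀ n, ∏ j ∈ Finset.range (d + 1), (h (n + (j : ℕ)) : Grp d).1 0 0 = 1 := by
    intro n
    have := congrArg Matrix.det (h₁ n)
    rwa [Matrix.det_diagonal, (h n : Grp d).2, Fin.prod_univ_eq_prod_range
      (fun j : ℕ => (h (n + (j : ZMod N)) : Grp d).1 0 0)] at this
  have h₃ : ∀ n, (h (n + (d + 1 : ℕ)) : Grp d).1 0 0 = (h n : Grp d).1 0 0 := by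
    intro n
    have e₁ := h₂ n
    have e₂ := h₂ (n + 1)
    rw [Finset.prod_range_succ'] at e₁
    rw [Finset.prod_range_succ] at e₂
    simp only [Nat.cast_zero, add_zero, Nat.cast_succ] at e₁ e₂ ⊢
    have e₃ : ∏ j ∈ Finset.range d, (h (n + 1 + (j : ZMod N)) : Grp d).1 0 0 =
        ∏ j ∈ Finset.range d, (h (n + ((j : ZMod N) + 1)) : Grp d).1 0 0 :=
      Finset.prod_congr rfl fun j _ => by rw [add_assoc, add_comm (1 : ZMod N)]
    rw [e₃] at e₂
    have e₄ := mul_left_cancel₀ (left_ne_zero_of_mul (e₁.trans_ne one_ne_zero)) (e₂.trans e₁.symm)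
    rw [← e₄, add_assoc, add_comm (1 : ZMod N)]
  have h₄ := eq_of_add_eq hcop (x := fun n => (h n : Grp d).1 0 0) h₃
  have h₅ : ∀ n, (h n : Grp d).1 = Matrix.diagonal fun _ => (h 0 : Grp d).1 0 0 := by
    intro n
    rw [← h₁ n]
    congr 1
    funext j
    exact h₄ _
  have h₆ : ∀ n, frameMatrix (a n) = frameMatrix (a' n) := by
    intro n
    have e := coe_gauge_mul h (frameSection a) n
    rw [hh, h₅ n, h₅ (n + 1)] at e
    ext i j
    have e' := congrFun (congrFun e i) j
    rw [Matrix.mul_diagonal, Matrix.diagonal_mul, mul_comm] at e'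
    exact (mul_left_cancel₀ (parabolic_zero_zero_ne_zero (h 0)) e').symm
  funext n r
  have e := congrFun (congrFun (h₆ n) r.castSucc) 0
  rw [frameMatrix_castSucc_zero, frameMatrix_castSucc_zero] at e
  exact mul_left_cancel₀ (pow_ne_zero _ (by norm_num)) e

theorem invariantExtension_gauge [NeZero N] (hcop : Nat.Coprime N (d + 1))
    (f : Invariants d N → ℝ) (h : ZMod N → parabolic d) (a : Invariants d N) :
    invariantExtension f (gauge h (frameSection a)) = f a := by
  have hex : ∃ (a' : Invariants d N) (h' : ZMod N → parabolic d),
      gauge h' (frameSection a') = gauge h (frameSection a) := ⟨a, h, rfl⟩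
  rw [invariantExtension, dif_pos hex]
  obtain ⟨h', hh'⟩ := hex.choose_spec
  refine congrArg f (eq_of_gauge_eq hcop (h := h⁻¹ * h') ?_)
  rw [gauge_mul, hh', ← gauge_mul, inv_mul_cancel, gauge_one]

theorem invariantExtension_invariant [NeZero N] (hcop : Nat.Coprime N (d + 1))
    (f : Invariants d N → ℝ) (h : ZMod N → parabolic d) (L : ZMod N → Grp d) :
    invariantExtension f (gauge h L) = invariantExtension f L := by
  by_cases hL : L ∈ regularSet d N
  · obtain ⟨a, h', rfl⟩ := hL
    rw [← gauge_mul, invariantExtension_gauge hcop, invariantExtension_gauge hcop]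
  · have hL' : gauge h L ∉ regularSet d N := by
      rintro ⟨a, h', hh'⟩
      refine hL ⟨a, h⁻¹ * h', ?_⟩
      rw [gauge_mul, hh', ← gauge_mul, inv_mul_cancel, gauge_one]
    have hz : ∀ L : ZMod N → Grp d, L ∉ regularSet d N → invariantExtension f L = 0 := by
      intro L hL
      rw [invariantExtension]
      exact dif_neg hL
    rw [hz _ hL, hz _ hL']

end GaugeAction

/-! ### Smooth local invariants -/

section SmoothMatrices

variable {E : Type*} [NormedAddCommGroup E] [NormedSpace ℝ E] {k : ℕ} {x₀ : E}

/-- A matrix-valued map all of whose entries are smooth at a point. -/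
def SmoothEntries (A : E → Matrix (Fin k) (Fin k) ℝ) (x₀ : E) : Prop :=
  ∀ i j, ContDiffAt ℝ ∞ (fun x => A x i j) x₀

theorem SmoothEntries.det {A : E → Matrix (Fin k) (Fin k) ℝ} (hA : SmoothEntries A x₀) :
    ContDiffAt ℝ ∞ (fun x => (A x).det) x₀ := by
  simp only [Matrix.det_apply']
  exact ContDiffAt.sum fun σ _ => contDiffAt_const.mul (contDiffAt_prod fun i _ => hA _ _)

theorem SmoothEntries.adjugate {A : E → Matrix (Fin k) (Fin k) ℝ} (hA : SmoothEntries A x₀) :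
    SmoothEntries (fun x => (A x).adjugate) x₀ := by
  intro i j
  simp only [Matrix.adjugate_apply]
  refine SmoothEntries.det fun p q => ?_
  simp only [Matrix.updateRow_apply]
  split_ifs
  · exact contDiffAt_const
  · exact hA p q

theorem SmoothEntries.mul {A B : E → Matrix (Fin k) (Fin k) ℝ} (hA : SmoothEntries A x₀)
    (hB : SmoothEntries B x₀) : SmoothEntries (fun x => A x * B x) x₀ := by
  intro i j
  simp only [Matrix.mul_apply]
  exact ContDiffAt.sum fun l _ => (hA i l).mul (hB l j)

theorem SmoothEntries.mulVec {A : E → Matrix (Fin k) (Fin k) ℝ} (hA : SmoothEntries A x₀)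
    {v : E → Fin k → ℝ} (hv : ∀ i, ContDiffAt ℝ ∞ (fun x => v x i) x₀) (i : Fin k) :
    ContDiffAt ℝ ∞ (fun x => (A x).mulVec (v x) i) x₀ := by
  simp only [Matrix.mulVec, dotProduct]
  exact ContDiffAt.sum fun l _ => (hA i l).mul (hv l)

end SmoothMatrices

/-! ### Openness of the regular set and smooth extensions -/

section LocalInvariants

variable {d N : ℕ}

/-- The sum of `k` consecutive entries of a periodic sequence. -/
def windowSum (N k : ℕ) : (ZMod N → ℝ) →ₗ[ℝ] (ZMod N → ℝ) :=
  ∑ j ∈ Finset.range k, shift (j : ℤ)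

theorem windowSum_apply (k : ℕ) (x : ZMod N → ℝ) (n : ZMod N) :
    windowSum N k x n = ∑ j ∈ Finset.range k, x (n + (j : ZMod N)) := by
  simp [windowSum, shift_apply]

/-- Two adjacent windows with sum zero give x(n + k) = x(n); by coprimality x is constant, and k
times the constant is zero. -/
theorem windowSum_injective [NeZero N] {k : ℕ} (hk : k ≠ 0) (hcop : Nat.Coprime N k) :
    Function.Injective (windowSum N k) := by
  obtain ⟨k, rfl⟩ := Nat.exists_eq_succ_of_ne_zero hk
  rw [injective_iff_map_eq_zero]
  intro x hx
  have h₁ : ∀ n, x (n + (k + 1 : ℕ)) = x n := by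
    intro n
    have e₁ := congrFun hx n
    have e₂ := congrFun hx (n + 1)
    rw [windowSum_apply, Finset.sum_range_succ'] at e₁
    rw [windowSum_apply, Finset.sum_range_succ] at e₂
    have e₃ : ∑ j ∈ Finset.range k, x (n + 1 + (j : ZMod N)) =
        ∑ j ∈ Finset.range k, x (n + ((j + 1 : ℕ) : ZMod N)) :=
      Finset.sum_congr rfl fun j _ => by
        rw [add_assoc, add_comm (1 : ZMod N), Nat.cast_succ]
    have e₄ : n + ((k + 1 : ℕ) : ZMod N) = n + 1 + k := by push_cast; ring
    rw [e₃] at e₂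
    rw [Nat.cast_zero, add_zero] at e₁
    rw [e₄]
    simp only [Pi.zero_apply] at e₁ e₂
    linarith
  have h₂ := eq_of_add_eq hcop h₁
  funext n
  have e := congrFun hx n
  rw [windowSum_apply, Finset.sum_congr rfl fun j _ => (h₂ _).trans (h₂ n).symm] at e
  simpa [Nat.cast_add_one_ne_zero] using e

/-- The inverse of the sum of `k` consecutive entries, for `k` prime to the period. -/
def windowSumEquiv [NeZero N] {k : ℕ} (hk : k ≠ 0) (hcop : Nat.Coprime N k) :
    (ZMod N → ℝ) ≃ₗ[ℝ] (ZMod N → ℝ) :=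
  LinearEquiv.ofInjectiveEndo (windowSum N k) (windowSum_injective hk hcop)

/-- Near a known solution l, possibly with negative entries, the multiplicative correction is
positive. Its logarithm solves a linear window-sum equation, invertible by coprimality. -/
theorem exists_prod_eq_one [NeZero N] (hcop : Nat.Coprime N (d + 1)) (l : ZMod N → ℝ)
    (δ₀ : ZMod N → ℝ)
    (hl : ∀ n, δ₀ n * ∏ j : Fin (d + 1), l (n + (j : ℕ)) = 1) :
    ∃ Ψ : (ZMod N → ℝ) → ZMod N → ℝ, (∀ n, ContDiffAt ℝ ∞ (fun δ => Ψ δ n) δ₀) ∧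
      ∀ δ : ZMod N → ℝ, (∀ n, 0 < δ₀ n / δ n) →
        ∀ n, δ n * ∏ j : Fin (d + 1), Ψ δ (n + (j : ℕ)) = 1 := by
  set C := windowSumEquiv (N := N) d.succ_ne_zero hcop with hC
  refine ⟨fun δ n => l n * Real.exp (C.symm (fun i => Real.log (δ₀ i / δ i)) n), fun n => ?_,
    fun δ hδ n => ?_⟩
  · have h₀ : ∀ i, δ₀ i ≠ 0 := fun i => left_ne_zero_of_mul ((hl i).trans_ne one_ne_zero)
    have h₁ : ContDiffAt ℝ ∞ (fun (δ : ZMod N → ℝ) i => Real.log (δ₀ i / δ i)) δ₀ := by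
      refine contDiffAt_pi.2 fun i => ContDiffAt.log ?_ (div_ne_zero (h₀ i) (h₀ i))
      exact contDiffAt_const.div (contDiff_apply ℝ ℝ i).contDiffAt (h₀ i)
    have h₂ : ContDiff ℝ ∞ fun y : ZMod N → ℝ => C.symm y n :=
      (contDiff_apply ℝ ℝ n).comp C.symm.toLinearMap.toContinuousLinearMap.contDiff
    exact contDiffAt_const.mul (Real.contDiff_exp.contDiffAt.comp δ₀ (h₂.contDiffAt.comp δ₀ h₁))
  · rw [Finset.prod_mul_distrib, ← Real.exp_sum]
    have h₁ : ∑ j : Fin (d + 1), C.symm (fun i => Real.log (δ₀ i / δ i)) (n + (j : ℕ)) =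
        Real.log (δ₀ n / δ n) := by
      have := congrFun (C.apply_symm_apply fun i => Real.log (δ₀ i / δ i)) n
      rw [← this]
      change _ = windowSum N (d + 1) _ n
      rw [windowSum_apply, Finset.sum_range]
    have h₂ : δ n ≠ 0 := fun h => by simpa [h] using hδ n
    rw [h₁, Real.exp_log (hδ n)]
    field_simp
    linarith [hl n]

/-- The matrices with given entries. -/
def toMatrices (X : ZMod N → Fin (d + 1) → Fin (d + 1) → ℝ) :
    ZMod N → Matrix (Fin (d + 1)) (Fin (d + 1)) ℝ := fun n => Matrix.of (X n)

theorem smoothEntries_toMatrices [NeZero N] (n : ZMod N)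
    (X₀ : ZMod N → Fin (d + 1) → Fin (d + 1) → ℝ) :
    SmoothEntries (fun X => toMatrices X n) X₀ := fun i j =>
  ((contDiff_apply_apply ℝ ℝ i j).comp
    (contDiff_apply ℝ (Fin (d + 1) → Fin (d + 1) → ℝ) n)).contDiffAt

theorem contDiffAt_transport [NeZero N] (j : ℕ) (n : ZMod N)
    (X₀ : ZMod N → Fin (d + 1) → Fin (d + 1) → ℝ) (i : Fin (d + 1)) :
    ContDiffAt ℝ ∞ (fun X => transport (toMatrices X) j n i) X₀ := by
  induction j generalizing n i with
  | zero => exact contDiffAt_const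
  | succ j ih => exact (smoothEntries_toMatrices n X₀).adjugate.mulVec (fun i => ih (n + 1) i) i

theorem smoothEntries_transportFrame [NeZero N] (n : ZMod N)
    (X₀ : ZMod N → Fin (d + 1) → Fin (d + 1) → ℝ) :
    SmoothEntries (fun X => transportFrame (toMatrices X) n) X₀ :=
  fun i j => contDiffAt_transport j n X₀ i

theorem continuous_entries : Continuous (entries : (ZMod N → Grp d) → _) :=
  continuous_pi fun n => continuous_pi fun i => continuous_pi fun j =>
    ((continuous_apply_apply i j).comp
      (continuous_induced_dom (f := fun A : Grp d => A.1))).comp (continuous_apply n)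

/-- Scaling the transported frame to determinant one brings a point to the section. -/
theorem exists_gauge_frameSection (L : ZMod N → Grp d) (l : ZMod N → ℝ)
    (hl : ∀ n, (transportFrame (fun n => (L n).1) n).det * ∏ j : Fin (d + 1), l (n + (j : ℕ)) = 1)
    (B : ZMod N → Matrix (Fin (d + 1)) (Fin (d + 1)) ℝ)
    (hB : B = fun n => transportFrame (fun n => (L n).1) n *
      Matrix.diagonal fun j : Fin (d + 1) => l (n + (j : ℕ))) :
    ∃ h : ZMod N → parabolic d, gauge h (frameSection fun n r =>
      (-1) ^ (d + 1) * ((B (n + 1)).adjugate * (L n).1 * B n) r.castSucc 0) = L := by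
  have hdet : ∀ n, (B n).det = 1 := by
    intro n
    rw [hB, Matrix.det_mul, Matrix.det_diagonal, hl n]
  have hent : ∀ n i (j : Fin (d + 1)), B n i j =
      transport (fun n => (L n).1) j n i * l (n + (j : ℕ)) := by
    intro n i j
    simp only [hB, Matrix.mul_diagonal]
    rfl
  have hpar : ∀ n, (⟨B n, hdet n⟩ : Grp d) ∈ parabolic d := by
    intro n i hi
    change B n i 0 = 0
    rw [hent]
    simp [transport, hi]
  -- Lₙ undoes the last transport step, and the scalings of the two columns carry the same index n +
  -- r + 1.
  have hcol : ∀ n (r : Fin d), ((L n).1 * B n).col r.succ = (B (n + 1)).col r.castSucc := by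
    intro n r
    have h₁ : (B n).col r.succ = l (n + ((r : ℕ) + 1 : ℕ)) •
        (L n).1.adjugate.mulVec (transport (fun n => (L n).1) r (n + 1)) := by
      ext i
      rw [Matrix.col_apply, hent, mul_comm]
      rfl
    have h₂ : (B (n + 1)).col r.castSucc = l (n + ((r : ℕ) + 1 : ℕ)) •
        transport (fun n => (L n).1) r (n + 1) := by
      ext i
      rw [Matrix.col_apply, hent, mul_comm]
      rw [Nat.cast_succ, add_comm ((r : ℕ) : ZMod N) 1, ← add_assoc]
      rfl
    rw [h₂, ← Matrix.mulVec_single_one, ← Matrix.mulVec_mulVec, Matrix.mulVec_single_one, h₁,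
      Matrix.mulVec_smul, Matrix.mulVec_mulVec, Matrix.mul_adjugate,
      show (L n).1.det = 1 from (L n).2, one_smul, Matrix.one_mulVec]
  refine ⟨fun n => ⟨⟨B n, hdet n⟩, hpar n⟩, ?_⟩
  have key : ∀ n, frameMatrix (fun r : Fin d => (-1) ^ (d + 1) *
      ((B (n + 1)).adjugate * (L n).1 * B n) r.castSucc 0) =
        (B (n + 1)).adjugate * (L n).1 * B n := by
    intro n
    refine eq_frameMatrix ?_ fun i r => ?_
    · rw [Matrix.det_mul, Matrix.det_mul, Matrix.det_adjugate, hdet, hdet, one_pow,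
        show (L n).1.det = 1 from (L n).2, one_mul, one_mul]
    · have h₁ := congrArg (fun v => (B (n + 1)).adjugate.mulVec v i) (hcol n r)
      simp only [← Matrix.mulVec_single_one, Matrix.mulVec_mulVec, Matrix.adjugate_mul, hdet,
        one_smul, Matrix.one_mulVec] at h₁
      rw [Matrix.mulVec_single_one, Matrix.col_apply, ← mul_assoc, Pi.single_apply] at h₁
      exact h₁
  funext n
  rw [gauge, mul_inv_eq_iff_eq_mul]
  refine Subtype.ext ?_
  change B (n + 1) * frameMatrix _ = (L n).1 * B n
  rw [key, ← mul_assoc, ← mul_assoc, Matrix.mul_adjugate, hdet, one_smul, one_mul]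

/-- The transported frame is polynomial in the entries of L, and the scalings that give it
determinant one depend smoothly on its determinants. The rescaled frame is a gauge transformation to
the section, where the invariants are read off the first column. -/
theorem exists_local_invariants [NeZero N] (hcop : Nat.Coprime N (d + 1)) {L₀ : ZMod N → Grp d}
    (hL₀ : L₀ ∈ regularSet d N) :
    ∃ Φ : (ZMod N → Fin (d + 1) → Fin (d + 1) → ℝ) → Invariants d N,
      ContDiffAt ℝ ∞ Φ (entries L₀) ∧
      ∀ᶠ L in 𝓝 L₀, ∃ h : ZMod N → parabolic d, gauge h (frameSection (Φ (entries L))) = L := by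
  obtain ⟨a₀, h₀, hL⟩ := hL₀
  set δ : (ZMod N → Fin (d + 1) → Fin (d + 1) → ℝ) → ZMod N → ℝ :=
    fun X n => (transportFrame (toMatrices X) n).det with hδ
  have hδs : ContDiffAt ℝ ∞ δ (entries L₀) :=
    contDiffAt_pi.2 fun n => (smoothEntries_transportFrame n (entries L₀)).det
  have hl : ∀ n, δ (entries L₀) n *
      ∏ j : Fin (d + 1), (h₀ (n + (j : ℕ)) : Grp d).1 0 0 = 1 := by
    intro n
    have := congrArg Matrix.det (transportFrame_gauge h₀ a₀ n)
    rw [Matrix.det_mul, Matrix.det_diagonal, hL] at this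
    exact this.trans (h₀ n : Grp d).2
  obtain ⟨Ψ, hΨs, hΨ⟩ := exists_prod_eq_one hcop (fun n => (h₀ n : Grp d).1 0 0) _ hl
  set B : (ZMod N → Fin (d + 1) → Fin (d + 1) → ℝ) → ZMod N →
      Matrix (Fin (d + 1)) (Fin (d + 1)) ℝ := fun X n => transportFrame (toMatrices X) n *
        Matrix.diagonal fun j : Fin (d + 1) => Ψ (δ X) (n + (j : ℕ)) with hB
  have hBs : ∀ n, SmoothEntries (fun X => B X n) (entries L₀) := by
    refine fun n => (smoothEntries_transportFrame n _).mul fun i j => ?_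
    simp only [Matrix.diagonal_apply]
    split_ifs
    · exact (hΨs _).comp _ hδs
    · exact contDiffAt_const
  refine ⟨fun X n r => (-1) ^ (d + 1) *
    ((B X (n + 1)).adjugate * toMatrices X n * B X n) r.castSucc 0, ?_, ?_⟩
  · exact contDiffAt_pi.2 fun n => contDiffAt_pi.2 fun r => contDiffAt_const.mul
      ((((hBs (n + 1)).adjugate.mul (smoothEntries_toMatrices n _)).mul (hBs n)) _ _)
  · have hpos : ∀ᶠ L in 𝓝 L₀, ∀ n, 0 < δ (entries L₀) n / δ (entries L) n := by
      refine Filter.eventually_all.2 fun n => ?_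
      have hne : δ (entries L₀) n ≠ 0 := left_ne_zero_of_mul ((hl n).trans_ne one_ne_zero)
      have hc : ContinuousAt (fun L => δ (entries L₀) n / δ (entries L) n) L₀ :=
        continuousAt_const.div ((continuousAt_pi.1 hδs.continuousAt n).comp
          continuous_entries.continuousAt) hne
      refine hc.eventually_mem (isOpen_Ioi.mem_nhds ?_)
      rw [div_self hne]
      exact Set.mem_Ioi.2 one_pos
    filter_upwards [hpos] with L hLpos
    exact exists_gauge_frameSection L _ (hΨ (δ (entries L)) hLpos) _ rfl

theorem isOpen_regularSet [NeZero N] (hcop : Nat.Coprime N (d + 1)) : IsOpen (regularSet d N) := by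
  refine isOpen_iff_mem_nhds.2 fun L₀ hL₀ => ?_
  obtain ⟨Φ, -, h⟩ := exists_local_invariants hcop hL₀
  filter_upwards [h] with L hL
  exact ⟨_, hL⟩

theorem isInvariantExtension [NeZero N] (hcop : Nat.Coprime N (d + 1)) {f : Invariants d N → ℝ}
    (hf : ContDiff ℝ ∞ f) : IsInvariantExtension f (invariantExtension f) where
  invariant := invariantExtension_invariant hcop f
  extends_fun a := by
    have := invariantExtension_gauge hcop f 1 a
    rwa [gauge_one] at this
  smooth L₀ hL₀ := by
    obtain ⟨Φ, hΦ, h⟩ := exists_local_invariants hcop hL₀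
    refine ⟨f ∘ Φ, hf.contDiffAt.comp _ hΦ, ?_⟩
    filter_upwards [h] with L ⟨k, hk⟩
    have := invariantExtension_gauge hcop f k (Φ (entries L))
    rwa [hk] at this

end LocalInvariants

/-! ### Gradients of smooth functions on `G^N` -/

section MatrixCurves

variable {k : ℕ}

/-- Entrywise derivative at `0` of a curve of matrices. -/
def HasMatrixDeriv (A : ℝ → Matrix (Fin k) (Fin k) ℝ) (A' : Matrix (Fin k) (Fin k) ℝ) : Prop :=
  ∀ i j, HasDerivAt (fun t => A t i j) (A' i j) 0

theorem hasMatrixDeriv_const (A : Matrix (Fin k) (Fin k) ℝ) : HasMatrixDeriv (fun _ => A) 0 :=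
  fun _ _ => hasDerivAt_const _ _

theorem HasMatrixDeriv.mul {A B : ℝ → Matrix (Fin k) (Fin k) ℝ} {A' B' : Matrix (Fin k) (Fin k) ℝ}
    (hA : HasMatrixDeriv A A') (hB : HasMatrixDeriv B B') :
    HasMatrixDeriv (fun t => A t * B t) (A' * B 0 + A 0 * B') := by
  intro i j
  simp only [Matrix.add_apply, Matrix.mul_apply, ← Finset.sum_add_distrib]
  exact HasDerivAt.fun_sum fun l _ => (hA i l).mul (hB l j)

section

open scoped Matrix.Norms.Operator

theorem hasMatrixDeriv_exp (A : Matrix (Fin k) (Fin k) ℝ) :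
    HasMatrixDeriv (fun t : ℝ => NormedSpace.exp (t • A)) A := by
  intro i j
  have h := hasDerivAt_exp_smul_const (𝕂 := ℝ) A 0
  rw [zero_smul, NormedSpace.exp_zero, one_mul] at h
  exact (LinearMap.toContinuousLinearMap
    (Matrix.entryLinearMap ℝ ℝ i j : Matrix (Fin k) (Fin k) ℝ →ₗ[ℝ] ℝ)).hasFDerivAt.comp_hasDerivAt
      (0 : ℝ) h

/-- Such matrices form a subalgebra, closed because finite-dimensional, so it contains the limit of
the exponential series. -/
theorem exp_apply_zero_of_column {d : ℕ} {A : Matrix (Fin (d + 1)) (Fin (d + 1)) ℝ}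
    (hA : ∀ i, i ≠ 0 → A i 0 = 0) (i : Fin (d + 1)) (hi : i ≠ 0) :
    (NormedSpace.exp A) i 0 = 0 := by
  let S : Subalgebra ℝ (Matrix (Fin (d + 1)) (Fin (d + 1)) ℝ) :=
    { carrier := {B | ∀ i, i ≠ 0 → B i 0 = 0}
      mul_mem' := by
        intro B C hB hC i hi
        rw [Matrix.mul_apply]
        refine Finset.sum_eq_zero fun j _ => ?_
        by_cases hj : j = 0
        · rw [hj, hB i hi, zero_mul]
        · rw [hC j hj, mul_zero]
      add_mem' := by
        intro B C hB hC i hi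
        rw [Matrix.add_apply, hB i hi, hC i hi, add_zero]
      algebraMap_mem' := by
        intro r i hi
        simp [Matrix.algebraMap_matrix_apply, hi] }
  have hS : IsClosed (S : Set (Matrix (Fin (d + 1)) (Fin (d + 1)) ℝ)) :=
    Submodule.closed_of_finiteDimensional (Subalgebra.toSubmodule S)
  have : NormedSpace.exp A ∈ S := by
    rw [NormedSpace.exp_eq_tsum ℝ]
    refine hS.mem_of_tendsto (NormedSpace.expSeries_summable' (𝕂 := ℝ) A).hasSum
      (Filter.Eventually.of_forall fun s => ?_)
    exact S.sum_mem fun n _ => S.smul_mem (S.pow_mem hA n) _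
  exact this i hi

end

end MatrixCurves

/-! ### Existence and uniqueness of left and right gradients -/

section Gradients

variable {d N : ℕ}

theorem trace_coe_alg (ξ : Alg d) : (ξ : Matrix (Fin (d + 1)) (Fin (d + 1)) ℝ).trace = 0 :=
  LinearMap.mem_ker.1 ξ.2

/-- The traceless part of a matrix. -/
def traceless (M : Matrix (Fin (d + 1)) (Fin (d + 1)) ℝ) : Alg d :=
  ⟨M - (M.trace / (d + 1)) • 1, LinearMap.mem_ker.2 (by
    have : (d : ℝ) + 1 ≠ 0 := by positivity
    change (M - (M.trace / (d + 1)) • 1).trace = 0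
    rw [Matrix.trace_sub, Matrix.trace_smul, Matrix.trace_one, Fintype.card_fin, smul_eq_mul]
    push_cast
    field_simp
    ring)⟩

theorem coe_traceless (M : Matrix (Fin (d + 1)) (Fin (d + 1)) ℝ) :
    (traceless M : Matrix (Fin (d + 1)) (Fin (d + 1)) ℝ) = M - (M.trace / (d + 1)) • 1 := rfl

theorem trace_traceless_mul (M : Matrix (Fin (d + 1)) (Fin (d + 1)) ℝ) (ξ : Alg d) :
    ((traceless M : Matrix (Fin (d + 1)) (Fin (d + 1)) ℝ) * ξ.1).trace = (M * ξ.1).trace := by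
  rw [coe_traceless, sub_mul, Matrix.trace_sub, smul_mul_assoc, one_mul, Matrix.trace_smul,
    trace_coe_alg, smul_zero, sub_zero]

theorem eq_zero_of_sum_sq {k : ℕ} {Y : Matrix (Fin k) (Fin k) ℝ}
    (h : (Y * Y.transpose).trace = 0) : Y = 0 := by
  ext i j
  simp only [Matrix.trace, Matrix.diag_apply, Matrix.mul_apply, Matrix.transpose_apply] at h
  have h₁ := (Finset.sum_eq_zero_iff_of_nonneg
    fun i _ => Finset.sum_nonneg fun j _ => mul_self_nonneg (Y i j)).1 h i (Finset.mem_univ i)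
  have h₂ := (Finset.sum_eq_zero_iff_of_nonneg
    fun j _ => mul_self_nonneg (Y i j)).1 h₁ j (Finset.mem_univ j)
  exact mul_self_eq_zero.1 h₂

theorem continuousAt_of_entries {c : ℝ → ZMod N → Grp d} {t : ℝ}
    (h : ∀ n i j, ContinuousAt (fun t => (c t n).1 i j) t) : ContinuousAt c t := by
  refine continuousAt_pi.2 fun n => ?_
  refine (Topology.IsInducing.continuousAt_iff (g := fun A : Grp d => A.1) ⟨rfl⟩).2 ?_
  exact continuousAt_pi.2 fun i => continuousAt_pi.2 fun j => h n i j

variable [NeZero N]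

theorem eq_of_pairing_eq {X X' : ZMod N → Alg d} (h : ∀ ξ, pairing X ξ = pairing X' ξ) :
    X = X' := by
  funext n
  set Y : Matrix (Fin (d + 1)) (Fin (d + 1)) ℝ := (X n).1 - (X' n).1 with hY
  have htr : Y.transpose.trace = 0 := by
    rw [Matrix.trace_transpose, hY, Matrix.trace_sub, trace_coe_alg, trace_coe_alg, sub_zero]
  have h₁ := h (Pi.single n ⟨Y.transpose, LinearMap.mem_ker.2 htr⟩)
  have h₂ : ∀ X : ZMod N → Alg d, pairing X (Pi.single n ⟨Y.transpose, LinearMap.mem_ker.2 htr⟩) =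
      ((X n).1 * Y.transpose).trace := by
    intro X
    rw [pairing, Finset.sum_eq_single n]
    · simp
    · intro i _ hi
      simp [hi]
    · simp
  rw [h₂, h₂] at h₁
  have h₃ : (Y * Y.transpose).trace = 0 := by
    rw [hY, sub_mul, Matrix.trace_sub, ← hY, h₁, sub_self]
  exact Subtype.ext (sub_eq_zero.1 (eq_zero_of_sum_sq h₃))

theorem rightGradient_eq {F : (ZMod N → Grp d) → ℝ} {L : ZMod N → Grp d} {X : ZMod N → Alg d}
    (h : IsRightGradient F L X) : rightGradient F L = X := by
  have hex : ∃ X, IsRightGradient F L X := ⟨X, h⟩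
  rw [rightGradient, dif_pos hex]
  exact eq_of_pairing_eq fun ξ => (hex.choose_spec ξ).unique (h ξ)

theorem leftGradient_eq {F : (ZMod N → Grp d) → ℝ} {L : ZMod N → Grp d} {X : ZMod N → Alg d}
    (h : IsLeftGradient F L X) : leftGradient F L = X := by
  have hex : ∃ X, IsLeftGradient F L X := ⟨X, h⟩
  rw [leftGradient, dif_pos hex]
  exact eq_of_pairing_eq fun ξ => (hex.choose_spec ξ).unique (h ξ)

/-- The differential of a smooth function along curves, expressed by a sequence of matrices. -/
theorem exists_differential {F : (ZMod N → Grp d) → ℝ} {L : ZMod N → Grp d} (hF : SmoothAt F L) :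
    ∃ G : ZMod N → Matrix (Fin (d + 1)) (Fin (d + 1)) ℝ,
      ∀ (c : ℝ → ZMod N → Grp d) (δ : ZMod N → Matrix (Fin (d + 1)) (Fin (d + 1)) ℝ), c 0 = L →
        (∀ n, HasMatrixDeriv (fun t => (c t n).1) (δ n)) →
        HasDerivAt (fun t => F (c t)) (∑ n, (G n * δ n).trace) 0 := by
  obtain ⟨Φ, hΦ, hF⟩ := hF
  -- The indices i and j are exchanged so that tr(Gδ) is the differential evaluated at δ.
  refine ⟨fun n => Matrix.of fun i j =>
    fderiv ℝ Φ (entries L) (Pi.single n (Pi.single j (Pi.single i 1))), fun c δ hc hδ => ?_⟩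
  have h₁ : HasDerivAt (fun t => entries (c t)) (fun n i j => δ n i j) 0 :=
    hasDerivAt_pi.2 fun n => hasDerivAt_pi.2 fun i => hasDerivAt_pi.2 fun j => hδ n i j
  have h₂ : HasFDerivAt Φ (fderiv ℝ Φ (entries L)) (entries (c 0)) := by
    rw [hc]
    exact (hΦ.differentiableAt (by simp)).hasFDerivAt
  have h₃ := h₂.comp_hasDerivAt (0 : ℝ) h₁
  have h₄ : ContinuousAt c 0 := continuousAt_of_entries fun n i j => (hδ n i j).continuousAt
  have h₅ : (fun t => F (c t)) =ᶠ[𝓝 0] Φ ∘ fun t => entries (c t) := by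
    rw [← hc] at hF
    exact h₄.eventually hF
  refine (h₃.congr_of_eventuallyEq h₅).congr_deriv ?_
  have h₆ : (fun n i j => δ n i j : ZMod N → Fin (d + 1) → Fin (d + 1) → ℝ) =
      ∑ n, ∑ i, ∑ j, δ n i j • Pi.single n (Pi.single i (Pi.single j (1 : ℝ))) := by
    funext n i j
    simp [Finset.sum_apply, Pi.single_apply, apply_ite, ite_apply]
  rw [h₆]
  simp only [map_sum, map_smul, smul_eq_mul, Matrix.trace, Matrix.diag_apply, Matrix.mul_apply,
    Matrix.of_apply]
  refine Finset.sum_congr rfl fun n _ => ?_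
  rw [Finset.sum_comm]
  exact Finset.sum_congr rfl fun i _ => Finset.sum_congr rfl fun j _ => mul_comm _ _

theorem hasMatrixDeriv_expSL (ξ : Alg d) :
    HasMatrixDeriv (fun t : ℝ => (expSL (t • ξ)).1) ξ.1 :=
  hasMatrixDeriv_exp ξ.1

theorem expSL_zero_smul (ξ : Alg d) : expSL ((0 : ℝ) • ξ) = 1 := by
  rw [zero_smul]
  exact Subtype.ext NormedSpace.exp_zero

theorem expSL_neg (ξ : Alg d) : expSL (-ξ) = (expSL ξ)⁻¹ := by
  refine eq_inv_of_mul_eq_one_left (Subtype.ext ?_)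
  change NormedSpace.exp (-ξ.1) * NormedSpace.exp ξ.1 = 1
  rw [← Matrix.exp_add_of_commute _ _ (Commute.refl ξ.1).neg_left, neg_add_cancel,
    NormedSpace.exp_zero]

theorem gradients_of_differential {F : (ZMod N → Grp d) → ℝ} {L : ZMod N → Grp d}
    {G : ZMod N → Matrix (Fin (d + 1)) (Fin (d + 1)) ℝ}
    (hG : ∀ (c : ℝ → ZMod N → Grp d) (δ : ZMod N → Matrix (Fin (d + 1)) (Fin (d + 1)) ℝ),
      c 0 = L → (∀ n, HasMatrixDeriv (fun t => (c t n).1) (δ n)) →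
        HasDerivAt (fun t => F (c t)) (∑ n, (G n * δ n).trace) 0) :
    rightGradient F L = (fun n => traceless (G n * (L n).1)) ∧
      leftGradient F L = fun n => traceless ((L n).1 * G n) := by
  constructor
  · refine rightGradient_eq fun ξ => ?_
    refine (hG (fun t n => L n * expSL (t • ξ n)) (fun n => (L n).1 * (ξ n).1) ?_ ?_).congr_deriv ?_
    · funext n
      rw [expSL_zero_smul, mul_one]
    · intro n
      have h := (hasMatrixDeriv_const (L n).1).mul (hasMatrixDeriv_expSL (ξ n))
      rw [zero_mul, zero_add] at h
      exact h
    · refine Finset.sum_congr rfl fun n _ => ?_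
      rw [trace_traceless_mul, mul_assoc]
  · refine leftGradient_eq fun ξ => ?_
    refine (hG (fun t n => expSL (t • ξ n) * L n) (fun n => (ξ n).1 * (L n).1) ?_ ?_).congr_deriv ?_
    · funext n
      rw [expSL_zero_smul, one_mul]
    · intro n
      have h := (hasMatrixDeriv_expSL (ξ n)).mul (hasMatrixDeriv_const (L n).1)
      rw [mul_zero, add_zero] at h
      exact h
    · refine Finset.sum_congr rfl fun n _ => ?_
      rw [trace_traceless_mul, ← mul_assoc, Matrix.trace_mul_cycle]

end Gradients

/-! ### Gradients of invariant extensions along the section -/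

section SectionGradients

variable {d N : ℕ} [NeZero N]

/-- The equations satisfied by the right gradient `Q` and the left gradient `P`, at the point of
the section with invariants `a`, of the invariant extension of a function with differential `ξ`. -/
structure IsGradientPair (a : Invariants d N) (ξ : Invariants d N →L[ℝ] ℝ)
    (Q P : ZMod N → Matrix (Fin (d + 1)) (Fin (d + 1)) ℝ) : Prop where
  mul_eq : ∀ n, P n * frameMatrix (a n) = frameMatrix (a n) * Q n
  apply_eq : ∀ n i j, ¬(i = 0 ∧ j ≠ 0) → P n i j = Q (n + 1) i j
  first_row : ∀ n (r : Fin d),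
    Q n 0 r.succ = (-1) ^ (d + 1) * ξ (Pi.single n (Pi.single r 1))

/-- An invariant function is constant along the gauge orbit t ↦ exp(tη)·L, whose velocity at n is
ηₙ₊₁Lₙ - Lₙηₙ. -/
theorem gauge_orthogonal {G : ZMod N → Matrix (Fin (d + 1)) (Fin (d + 1)) ℝ}
    {F : (ZMod N → Grp d) → ℝ} {L : ZMod N → Grp d}
    (hG : ∀ (c : ℝ → ZMod N → Grp d) (δ : ZMod N → Matrix (Fin (d + 1)) (Fin (d + 1)) ℝ),
      c 0 = L → (∀ n, HasMatrixDeriv (fun t => (c t n).1) (δ n)) →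
        HasDerivAt (fun t => F (c t)) (∑ n, (G n * δ n).trace) 0)
    (hF : ∀ (h : ZMod N → parabolic d) (L : ZMod N → Grp d), F (gauge h L) = F L)
    (η : ZMod N → Alg d) (hη : ∀ n i, i ≠ 0 → (η n).1 i 0 = 0) :
    ∑ n, (G n * ((η (n + 1)).1 * (L n).1 - (L n).1 * (η n).1)).trace = 0 := by
  have hpar : ∀ (t : ℝ) n, expSL (t • η n) ∈ parabolic d := by
    intro t n
    refine exp_apply_zero_of_column fun i hi => ?_
    change t * (η n).1 i 0 = 0
    rw [hη n i hi, mul_zero]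
  have h := hG (fun t => gauge (fun n => ⟨expSL (t • η n), hpar t n⟩) L)
    (fun n => (η (n + 1)).1 * (L n).1 - (L n).1 * (η n).1) ?_ ?_
  · simp only [hF] at h
    exact h.unique (hasDerivAt_const _ _)
  · funext n
    simp only [gauge, expSL_zero_smul]
    simp
  · intro n
    have h₁ := hasMatrixDeriv_expSL (-η n)
    have h₂ := ((hasMatrixDeriv_expSL (η (n + 1))).mul (hasMatrixDeriv_const (L n).1)).mul h₁
    simp only [expSL_zero_smul] at h₂
    simp only [Matrix.SpecialLinearGroup.coe_one, mul_zero, add_zero, mul_one, one_mul] at h₂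
    have h₃ : (fun t : ℝ => (gauge (fun n => ⟨expSL (t • η n), hpar t n⟩) L n).1) =
        fun t : ℝ => (expSL (t • η (n + 1))).1 * (L n).1 * (expSL (t • -η n)).1 := by
      funext t
      rw [smul_neg, expSL_neg]
      rfl
    rw [h₃]
    refine fun i j => (h₂ i j).congr_deriv ?_
    refine congrFun (congrFun ?_ i) j
    change _ + (L n).1 * (-(η n).1) = _
    rw [mul_neg, sub_eq_add_neg]

/-- A matrix orthogonal to the traceless matrices stabilizing the first basis line is concentrated
in the first row. -/
theorem apply_eq_zero_of_orthogonal {Y : Matrix (Fin (d + 1)) (Fin (d + 1)) ℝ} (htr : Y.trace = 0)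
    (h : ∀ B : Alg d, (∀ i, i ≠ 0 → B.1 i 0 = 0) → (Y * B.1).trace = 0) (i j : Fin (d + 1))
    (hij : ¬(i = 0 ∧ j ≠ 0)) : Y i j = 0 := by
  set Z : Matrix (Fin (d + 1)) (Fin (d + 1)) ℝ :=
    Matrix.of fun i j => if i = 0 ∧ j ≠ 0 then 0 else Y i j with hZ
  have hZtr : Z.transpose.trace = 0 := by
    rw [Matrix.trace_transpose, ← htr]
    refine Finset.sum_congr rfl fun i _ => ?_
    simp only [hZ, Matrix.diag_apply, Matrix.of_apply]
    rw [if_neg fun h => h.2 h.1]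
  -- Erasing the off-diagonal first row of Y makes the transpose an admissible test matrix, against
  -- which Y pairs to the sum of squares of its remaining entries.
  have h₁ := h ⟨Z.transpose, LinearMap.mem_ker.2 hZtr⟩ fun i hi => by simp [hZ, hi]
  have h₂ : (Z * Z.transpose).trace = 0 := by
    rw [← h₁]
    simp only [Matrix.trace, Matrix.diag_apply, Matrix.mul_apply, Matrix.transpose_apply]
    refine Finset.sum_congr rfl fun i _ => Finset.sum_congr rfl fun j _ => ?_
    by_cases hc : i = 0 ∧ j ≠ 0
    · simp [hZ, hc]
    · simp only [hZ, Matrix.of_apply, if_neg hc]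
  have h₃ := congrFun (congrFun (eq_zero_of_sum_sq h₂) i) j
  simpa [hZ, if_neg hij] using h₃

/-- With differential G, the gradients are the traceless parts of LG and GL, whence PL = LQ. Gauge
invariance puts Pₙ - Qₙ₊₁ in the first row, off the corner. Differentiating along the section, where
only the first column of L moves, gives the first row of Q. -/
theorem isGradientPair (hcop : Nat.Coprime N (d + 1)) {f : Invariants d N → ℝ}
    (hf : ContDiff ℝ ∞ f) (a : Invariants d N) :
    IsGradientPair a (fderiv ℝ f a)
      (fun n => (rightGradient (invariantExtension f) (frameSection a) n).1)
      (fun n => (leftGradient (invariantExtension f) (frameSection a) n).1) := by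
  have hF := isInvariantExtension hcop hf
  obtain ⟨G, hG⟩ := exists_differential
    (hF.smooth (frameSection a) ⟨a, 1, gauge_one _⟩)
  obtain ⟨hQ, hP⟩ := gradients_of_differential hG
  rw [hQ, hP]
  refine ⟨fun n => ?_, fun n i j hij => ?_, fun n r => ?_⟩
  · change (traceless (frameMatrix (a n) * G n)).1 * frameMatrix (a n) =
      frameMatrix (a n) * (traceless (G n * frameMatrix (a n))).1
    rw [coe_traceless, coe_traceless, Matrix.trace_mul_comm (frameMatrix (a n)), sub_mul, mul_sub,
      smul_mul_assoc, one_mul, mul_smul_comm, mul_one, mul_assoc]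
  · rw [← sub_eq_zero, ← Matrix.sub_apply]
    refine apply_eq_zero_of_orthogonal ?_ (fun B hB => ?_) i j hij
    · rw [Matrix.trace_sub, trace_coe_alg, trace_coe_alg, sub_zero]
    · have h := gauge_orthogonal hG hF.invariant (Pi.single (n + 1) B) (fun k i hi => by
        by_cases hk : k = n + 1
        · subst hk
          simpa using hB i hi
        · simp [hk])
      have h₁ : ∀ k, (G k * (((Pi.single (n + 1) B : ZMod N → Alg d) (k + 1)).1 *
          (frameSection a k).1 - (frameSection a k).1 *
            ((Pi.single (n + 1) B : ZMod N → Alg d) k).1)).trace =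
          ((traceless ((frameSection a k).1 * G k)).1 *
            ((Pi.single (n + 1) B : ZMod N → Alg d) (k + 1)).1).trace -
          ((traceless (G k * (frameSection a k).1)).1 *
            ((Pi.single (n + 1) B : ZMod N → Alg d) k).1).trace := by
        intro k
        rw [trace_traceless_mul, trace_traceless_mul, mul_sub, Matrix.trace_sub, ← mul_assoc,
          Matrix.trace_mul_cycle, ← mul_assoc]
      simp only [h₁, Finset.sum_sub_distrib] at h
      rw [Finset.sum_eq_single n, Finset.sum_eq_single (n + 1)] at h
      · simpa [sub_mul] using h
      · intro k _ hk
        simp [hk]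
      · simp
      · intro k _ hk
        simp [hk]
      · simp
  · set b : Invariants d N := Pi.single n (Pi.single r 1) with hb
    have h₁ : HasDerivAt (fun t : ℝ => f (a + t • b)) (fderiv ℝ f a b) 0 := by
      have h₂ : HasDerivAt (fun t : ℝ => a + t • b) b 0 := by
        simpa using ((hasDerivAt_id (0 : ℝ)).smul_const b).const_add a
      have h₃ : HasFDerivAt f (fderiv ℝ f a) (a + (0 : ℝ) • b) := by
        rw [zero_smul, add_zero]
        exact (hf.differentiable (by simp) a).hasFDerivAt
      exact h₃.comp_hasDerivAt (0 : ℝ) h₂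
    have h₂ := hG (fun t => frameSection (a + t • b))
      (Pi.single n (Matrix.single r.castSucc 0 ((-1) ^ (d + 1)))) (by simp) (fun k i j => ?_)
    · simp only [hF.extends_fun] at h₂
      have h₃ := h₂.unique h₁
      rw [Finset.sum_eq_single n] at h₃
      · rw [← h₃, Pi.single_eq_same, Matrix.trace_mul_comm, Matrix.trace_single_mul,
          smul_eq_mul, ← mul_assoc, ← mul_pow]
        rw [coe_traceless, Matrix.sub_apply, Matrix.smul_apply, Matrix.one_apply_ne
          (Fin.succ_ne_zero r).symm, smul_zero, sub_zero, Matrix.mul_apply,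
          Finset.sum_eq_single r.castSucc]
        · change _ * frameMatrix (a n) _ _ = _
          rw [frameMatrix_succ, if_pos rfl]
          simp
        · intro k _ hk
          change _ * frameMatrix (a n) _ _ = _
          rw [frameMatrix_succ, if_neg hk, mul_zero]
        · simp
      · intro k _ hk
        simp [hk]
      · simp
    · change HasDerivAt (fun t : ℝ => frameMatrix ((a + t • b) k) i j) _ 0
      refine Fin.cases ?_ (fun s => ?_) j
      · refine Fin.lastCases ?_ (fun s => ?_) i
        · simp only [frameMatrix_last_zero]
          refine (hasDerivAt_const _ _).congr_deriv ?_
          by_cases hk : k = n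
          · subst hk
            simp [(Fin.castSucc_lt_last r).ne]
          · simp [hk]
        · simp only [frameMatrix_castSucc_zero]
          have h₃ : HasDerivAt (fun t : ℝ => (-1) ^ (d + 1) * (a + t • b) k s)
              ((-1) ^ (d + 1) * b k s) 0 := by
            refine HasDerivAt.const_mul _ ?_
            simpa using ((hasDerivAt_id (0 : ℝ)).mul_const (b k s)).const_add (a k s)
          refine h₃.congr_deriv ?_
          by_cases hk : k = n
          · subst hk
            by_cases hs : s = r
            · simp [hb, hs]
            · simp [hb, hs, Ne.symm hs]
          · simp [hb, hk]
      · simp only [frameMatrix_succ]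
        refine (hasDerivAt_const _ _).congr_deriv ?_
        by_cases hk : k = n
        · subst hk
          simp [(Fin.succ_ne_zero s).symm]
        · simp [hk]

end SectionGradients

/-! ### The reduced brackets in terms of difference operators -/

section FirstColumn

variable {d N : ℕ} {a : Invariants d N} {ξ : Invariants d N →L[ℝ] ℝ}
  {Q P : ZMod N → Matrix (Fin (d + 1)) (Fin (d + 1)) ℝ}

theorem mul_frameMatrix_succ (M : Matrix (Fin (d + 1)) (Fin (d + 1)) ℝ) (b : Fin d → ℝ)
    (i : Fin (d + 1)) (s : Fin d) : (M * frameMatrix b) i s.succ = M i s.castSucc := by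
  rw [Matrix.mul_apply, Finset.sum_eq_single s.castSucc]
  · rw [frameMatrix_succ, if_pos rfl, mul_one]
  · intro k _ hk
    rw [frameMatrix_succ, if_neg hk, mul_zero]
  · simp

theorem frameMatrix_mul_castSucc (M : Matrix (Fin (d + 1)) (Fin (d + 1)) ℝ) (b : Fin d → ℝ)
    (r : Fin d) (j : Fin (d + 1)) :
    (frameMatrix b * M) r.castSucc j = (-1) ^ (d + 1) * b r * M 0 j + M r.succ j := by
  rw [Matrix.mul_apply, Fin.sum_univ_succ, frameMatrix_castSucc_zero, Finset.sum_eq_single r]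
  · rw [frameMatrix_succ, if_pos rfl, one_mul]
  · intro k _ hk
    rw [frameMatrix_succ, if_neg (fun h => hk (Fin.castSucc_injective d h).symm), zero_mul]
  · simp

theorem frameMatrix_mul_last (M : Matrix (Fin (d + 1)) (Fin (d + 1)) ℝ) (b : Fin d → ℝ)
    (j : Fin (d + 1)) : (frameMatrix b * M) (Fin.last d) j = (-1) ^ d * M 0 j := by
  rw [Matrix.mul_apply, Fin.sum_univ_succ, frameMatrix_last_zero, Finset.sum_eq_zero, add_zero]
  intro k _
  rw [frameMatrix_succ, if_neg (Fin.castSucc_lt_last k).ne', zero_mul]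

theorem neg_one_pow_mul_self (k : ℕ) : (-1 : ℝ) ^ k * (-1) ^ k = 1 := by
  rw [← mul_pow]
  simp

/-- Off the first row Qₙ₊₁ is Pₙ, and PₙLₙ = LₙQₙ compares an entry of Pₙ with the next entry of Qₙ
down the same diagonal. The extra term comes from the known first row of Q. -/
theorem IsGradientPair.step (h : IsGradientPair a ξ Q P) (n : ZMod N) (r s : Fin d)
    (hr : r.castSucc ≠ 0) : Q (n + 1) r.castSucc s.castSucc =
      a n r * ξ (Pi.single n (Pi.single s 1)) + Q n r.succ s.succ := by
  rw [← h.apply_eq n _ _ fun hc => hr hc.1, ← mul_frameMatrix_succ (P n) (a n), h.mul_eq,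
    frameMatrix_mul_castSucc, h.first_row]
  linear_combination a n r * ξ (Pi.single n (Pi.single s 1)) * neg_one_pow_mul_self (d + 1)

theorem IsGradientPair.step_last (h : IsGradientPair a ξ Q P) (n : ZMod N) (s : Fin d) :
    Q (n + 1) (Fin.last d) s.castSucc = -ξ (Pi.single n (Pi.single s 1)) := by
  have hd : Fin.last d ≠ 0 := ((Fin.zero_le _).trans_lt (Fin.castSucc_lt_last s)).ne'
  rw [← h.apply_eq n _ _ fun hc => hd hc.1, ← mul_frameMatrix_succ (P n) (a n), h.mul_eq,
    frameMatrix_mul_last, h.first_row, pow_succ]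
  linear_combination -ξ (Pi.single n (Pi.single s 1)) * neg_one_pow_mul_self d

/-- The components of a covector, extended by zero. -/
def component (ξ : Invariants d N →L[ℝ] ℝ) (p : ℕ) (n : ZMod N) : ℝ :=
  if h : p < d then ξ (Pi.single n (Pi.single ⟨p, h⟩ 1)) else 0

theorem co_covectorOp_mul (x : DiffOp N) (k : ℤ) (n : ZMod N) :
    co k (covectorOp ξ * x) n = ∑ p ∈ Finset.range d,
      component ξ p (n - (p + 1)) * co (k + p + 1) x (n - (p + 1)) := by
  rw [covectorOp_apply, Finset.sum_mul, map_sum, Finset.sum_apply, Finset.sum_range]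
  refine Finset.sum_congr rfl fun p _ => ?_
  rw [co_mono_mul, Pi.mul_apply, shift_apply, shift_apply, component, dif_pos p.2]
  have h₁ : n + ((-((p : ℤ) + 1) : ℤ) : ZMod N) = n - ((p : ℕ) + 1) := by
    push_cast
    ring
  rw [h₁, sub_neg_eq_add, add_assoc k]

/-- Induction on the distance k = d - i to the last row, moving down the diagonal with `step` and
ending with `step_last`. The zero extension in `component` and the degree bound on D allow the same
summation range for every entry; e is arbitrary because only coefficients of positive degree occur.
-/
theorem IsGradientPair.lower_entry (h : IsGradientPair a ξ Q P) (e : ℝ) (k : ℕ) :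
    ∀ i j : ℕ, ∀ (hi : i < d + 1) (hj : j < i), i + k = d → ∀ n,
      Q n ⟨i, hi⟩ ⟨j, hj.trans hi⟩ = -∑ p ∈ Finset.range d,
        component ξ (j + p) (n - (p + 1)) * co (i + p + 1) (laxOp e a) (n - (p + 1)) := by
  have hcomp : ∀ (p : ℕ) (hp : p < d) (n : ZMod N),
      component ξ p n = ξ (Pi.single n (Pi.single ⟨p, hp⟩ 1)) := fun p hp n => dif_pos hp
  induction k with
  | zero =>
    intro i j hi hj hid n
    obtain rfl : i = d := by omega
    have h₁ := h.step_last (n - 1) ⟨j, hj⟩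
    rw [sub_add_cancel] at h₁
    refine h₁.trans (congrArg Neg.neg ?_)
    rw [Finset.sum_eq_single_of_mem 0 (Finset.mem_range.2 (by omega))]
    · rw [← hcomp j hj]
      simp [co_laxOp_top]
    · intro p _ hp
      rw [co_laxOp_of_gt _ _ (by omega), Pi.zero_apply, mul_zero]
  | succ k ih =>
    intro i j hi hj hid n
    obtain ⟨d', rfl⟩ : ∃ d', d = d' + 1 := ⟨d - 1, by omega⟩
    have h₁ := h.step (n - 1) ⟨i, by omega⟩ ⟨j, by omega⟩
      (fun h0 => by simp [Fin.ext_iff] at h0; omega)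
    rw [sub_add_cancel] at h₁
    have h₂ := ih (i + 1) (j + 1) (by omega) (by omega) (by omega) (n - 1)
    refine h₁.trans ?_
    change _ + Q (n - 1) ⟨i + 1, _⟩ ⟨j + 1, _⟩ = _
    rw [h₂, Finset.sum_range_succ, Finset.sum_range_succ' _ d']
    have h₃ : co (((i + 1 : ℕ) : ℤ) + d' + 1) (laxOp e a) = 0 :=
      co_laxOp_of_gt _ _ (by push_cast; omega)
    have h₄ : co ((i : ℤ) + ((0 : ℕ) : ℤ) + 1) (laxOp e a) = fun n => -a n ⟨i, by omega⟩ := by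
      rw [Nat.cast_zero, add_zero]
      exact co_laxOp_fin e a ⟨i, by omega⟩
    rw [h₃, h₄, Pi.zero_apply, mul_zero, add_zero, ← hcomp j (by omega), Nat.cast_zero, zero_add,
      add_zero]
    have h₅ : ∑ p ∈ Finset.range d', component ξ (j + 1 + p) (n - 1 - (p + 1)) *
        co (((i + 1 : ℕ) : ℤ) + p + 1) (laxOp e a) (n - 1 - (p + 1)) =
      ∑ p ∈ Finset.range d', component ξ (j + (p + 1)) (n - ((p + 1 : ℕ) + 1)) *
        co ((i : ℤ) + (p + 1 : ℕ) + 1) (laxOp e a) (n - ((p + 1 : ℕ) + 1)) := by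
      refine Finset.sum_congr rfl fun p _ => ?_
      have e₁ : n - 1 - ((p : ZMod N) + 1) = n - (((p + 1 : ℕ) : ZMod N) + 1) := by
        push_cast; ring
      have e₂ : ((i + 1 : ℕ) : ℤ) + p + 1 = (i : ℤ) + (p + 1 : ℕ) + 1 := by push_cast; ring
      rw [e₁, e₂, add_assoc j, add_comm 1 p]
    rw [h₅]
    ring

/-- The first column of the right gradient. -/
theorem IsGradientPair.first_column (h : IsGradientPair a ξ Q P) (e : ℝ) (r : Fin d)
    (n : ZMod N) : co (r + 1) (covectorOp ξ * laxOp e a) n = -Q n r.succ 0 := by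
  have h₁ := h.lower_entry e (d - (r + 1)) (r + 1) 0 (by omega) (by omega) (by omega) n
  change Q n r.succ 0 = _ at h₁
  rw [h₁, neg_neg, co_covectorOp_mul]
  refine Finset.sum_congr rfl fun p _ => ?_
  rw [zero_add, Nat.cast_succ]

end FirstColumn

/-! ### The r-matrix terms in matrix entries -/

section Brackets

variable {d : ℕ}

theorem trace_gradeNegOne_mul_gradeOne (X Y : Alg d) :
    (gradeNegOne X * gradeOne Y).trace = ∑ r : Fin d, X.1 r.succ 0 * Y.1 0 r.succ := by
  simp only [Matrix.trace, Matrix.diag_apply, Matrix.mul_apply, gradeNegOne, gradeOne,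
    Matrix.of_apply]
  simp [Fin.sum_univ_succ, Fin.succ_ne_zero]

theorem rWedge_eq (X Y : Alg d) : rWedge X Y = (1 / 2) * ∑ i, ∑ j,
    if j < i then X.1 i j * Y.1 j i - X.1 j i * Y.1 i j else 0 := by
  have h₁ : rWedge X Y = (1 / 2) * ((∑ i, ∑ j, if j < i then X.1 i j * Y.1 j i else 0)
      - ∑ i, ∑ j, if i < j then X.1 i j * Y.1 j i else 0) := by
    rw [rWedge, rMatrix, Matrix.mul_smul, Matrix.trace_smul, smul_eq_mul, mul_sub (X.1),
      Matrix.trace_sub]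
    simp only [Matrix.trace, Matrix.diag_apply, Matrix.mul_apply, upper, lower, Matrix.of_apply,
      mul_ite, mul_zero]
  rw [h₁, Finset.sum_comm (f := fun i j => if i < j then X.1 i j * Y.1 j i else 0),
    ← Finset.sum_sub_distrib]
  refine congrArg _ (Finset.sum_congr rfl fun i _ => ?_)
  rw [← Finset.sum_sub_distrib]
  refine Finset.sum_congr rfl fun j _ => ?_
  split_ifs <;> simp

theorem rTensor_eq (X Y : Alg d) : rTensor X Y = ∑ i, ∑ j,
    if j < i then X.1 i j * Y.1 j i else 0 := by
  simp only [rTensor, Matrix.trace, Matrix.diag_apply, Matrix.mul_apply, upper, lower,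
    Matrix.of_apply]
  refine Finset.sum_congr rfl fun i _ => Finset.sum_congr rfl fun j _ => ?_
  split_ifs <;> simp

/-- On elements that agree up to the first row, the summand of the twisted bracket only involves
the differences of the first rows. -/
theorem twisted_summand {X Y X' Y' : Alg d}
    (h : ∀ i j, ¬(i = 0 ∧ j ≠ 0) → X.1 i j = Y.1 i j)
    (h' : ∀ i j, ¬(i = 0 ∧ j ≠ 0) → X'.1 i j = Y'.1 i j) :
    rWedge X X' + rWedge Y Y' - rTensor Y X' + rTensor Y' X =
      (1 / 2) * ((Y'.1 * (X.1 - Y.1)).trace - (Y.1 * (X'.1 - Y'.1)).trace) := by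
  simp only [rWedge_eq, rTensor_eq, Matrix.trace, Matrix.diag_apply, Matrix.mul_apply,
    Matrix.sub_apply, Finset.mul_sum, mul_sub, ← Finset.sum_add_distrib,
    ← Finset.sum_sub_distrib]
  refine Finset.sum_congr rfl fun i _ => Finset.sum_congr rfl fun j _ => ?_
  by_cases hij : j < i
  · have hi : i ≠ 0 := ((Fin.zero_le j).trans_lt hij).ne'
    rw [if_pos hij, if_pos hij, if_pos hij, if_pos hij, h i j fun hc => hi hc.1,
      h' i j fun hc => hi hc.1]
    ring
  · have hji : ¬(j = 0 ∧ i ≠ 0) := fun hc => hij (hc.1 ▸ Fin.pos_of_ne_zero hc.2)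
    rw [if_neg hij, if_neg hij, if_neg hij, if_neg hij, h j i hji, h' j i hji]
    ring

end Brackets

/-! ### The action of difference operators on sequences of vectors -/

section Representation

variable {d N : ℕ}

/-- Periodic sequences of vectors in `ℝᵐ`, `m = d + 1`. -/
abbrev VecSeq (d N : ℕ) : Type := ZMod N → Fin (d + 1) → ℝ

/-- The twisted shift `(T w)ₙ = L(aₙ)⁻¹ wₙ₊₁`. -/
def twistedShift (a : Invariants d N) : (Module.End ℝ (VecSeq d N))ˣ where
  val :=
    { toFun := fun w n => ((frameSection a n)⁻¹).1.mulVec (w (n + 1))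
      map_add' := fun w w' => by funext n; exact Matrix.mulVec_add _ _ _
      map_smul' := fun c w => by funext n; exact Matrix.mulVec_smul _ c _ }
  inv :=
    { toFun := fun w n => (frameSection a (n - 1)).1.mulVec (w (n - 1))
      map_add' := fun w w' => by funext n; exact Matrix.mulVec_add _ _ _
      map_smul' := fun c w => by funext n; exact Matrix.mulVec_smul _ c _ }
  val_inv := by
    refine LinearMap.ext fun w => funext fun n => ?_
    change ((frameSection a n)⁻¹).1.mulVec ((frameSection a (n + 1 - 1)).1.mulVec
      (w (n + 1 - 1))) = w n
    rw [add_sub_cancel_right, Matrix.mulVec_mulVec, ← Matrix.SpecialLinearGroup.coe_mul,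
      inv_mul_cancel, Matrix.SpecialLinearGroup.coe_one, Matrix.one_mulVec]
  inv_val := by
    refine LinearMap.ext fun w => funext fun n => ?_
    change (frameSection a (n - 1)).1.mulVec (((frameSection a (n - 1))⁻¹).1.mulVec
      (w (n - 1 + 1))) = w n
    rw [sub_add_cancel, Matrix.mulVec_mulVec, ← Matrix.SpecialLinearGroup.coe_mul,
      mul_inv_cancel, Matrix.SpecialLinearGroup.coe_one, Matrix.one_mulVec]

/-- Multiplication of vector sequences by scalar sequences. -/
def scalarMul : (ZMod N → ℝ) →+* Module.End ℝ (VecSeq d N) where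
  toFun x :=
    { toFun := fun w n => x n • w n
      map_add' := fun w w' => by funext n; exact smul_add _ _ _
      map_smul' := fun c w => by funext n; exact smul_comm (x n) c (w n) }
  map_one' := LinearMap.ext fun w => funext fun n => one_smul ℝ (w n)
  map_mul' x y := LinearMap.ext fun w => funext fun n => mul_smul (x n) (y n) (w n)
  map_zero' := LinearMap.ext fun w => funext fun n => zero_smul ℝ (w n)
  map_add' x y := LinearMap.ext fun w => funext fun n => add_smul (x n) (y n) (w n)

/-- This is the relation T x = (shift 1 x) T for the twisted shift, in all powers; it is what lets
the skew algebra act. -/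
theorem scalarMul_shift_mul (a : Invariants d N) (k : ℤ) (x : ZMod N → ℝ) :
    scalarMul (shift k x) * (twistedShift a ^ k).val = (twistedShift a ^ k).val * scalarMul x := by
  have h₁ : ∀ x : ZMod N → ℝ, scalarMul (d := d) (shift 1 x) * (twistedShift a).1 =
      (twistedShift a).1 * scalarMul x := by
    refine fun x => LinearMap.ext fun w => funext fun n => ?_
    change x (n + ((1 : ℤ) : ZMod N)) • ((frameSection a n)⁻¹).1.mulVec (w (n + 1)) =
      ((frameSection a n)⁻¹).1.mulVec (x (n + 1) • w (n + 1))
    rw [Int.cast_one, Matrix.mulVec_smul]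
  have h₂ : ∀ x : ZMod N → ℝ, scalarMul (d := d) (shift (-1) x) * (twistedShift a)⁻¹.1 =
      (twistedShift a)⁻¹.1 * scalarMul x := by
    intro x
    rw [Units.mul_inv_eq_iff_eq_mul, mul_assoc, ← Units.inv_mul_eq_iff_eq_mul, inv_inv,
      ← h₁, shift_shift, add_neg_cancel, shift_zero]
  induction k generalizing x with
  | zero => simp [shift_zero]
  | succ k ih =>
    rw [zpow_add_one, Units.val_mul, ← mul_assoc, ← shift_shift, ih, mul_assoc, h₁, mul_assoc]
  | pred k ih =>
    rw [zpow_sub_one, Units.val_mul, ← mul_assoc, sub_eq_add_neg, ← shift_shift, ih, mul_assoc, h₂,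
      mul_assoc]

/-- The action of difference operators on vector sequences in which `T` is the twisted shift. -/
def opAction (a : Invariants d N) :
    DiffOp N →+* Module.End ℝ (VecSeq d N) :=
  SkewMonoidAlgebra.liftNCRingHom scalarMul
    ((Units.coeHom _).comp (zpowersHom _ (twistedShift a)))
    fun {x g} => scalarMul_shift_mul a g.toAdd x

theorem opAction_mono (a : Invariants d N) (k : ℤ) (x : ZMod N → ℝ) :
    opAction a (mono k x) = scalarMul x *
      ((twistedShift a ^ k : (Module.End ℝ (VecSeq d N))ˣ) : Module.End ℝ (VecSeq d N)) :=
  SkewMonoidAlgebra.liftNC_single _ _ _ _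

theorem opAction_mono_apply (a : Invariants d N) (k : ℤ) (x : ZMod N → ℝ)
    (w : VecSeq d N) (n : ZMod N) :
    opAction a (mono k x) w n = x n • opAction a (mono k 1) w n := by
  rw [opAction_mono, opAction_mono, map_one, one_mul]
  rfl

theorem opAction_mono_add_one (a : Invariants d N) (k : ℤ) (w : VecSeq d N)
    (n : ZMod N) : opAction a (mono (k + 1) 1) w n =
      ((frameSection a n)⁻¹).1.mulVec (opAction a (mono k 1) w (n + 1)) := by
  rw [opAction_mono, opAction_mono, map_one, one_mul, one_mul, add_comm k, zpow_one_add,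
    Units.val_mul]
  rfl

theorem inv_frameSection_mulVec_castSucc (a : Invariants d N) (n : ZMod N) (r : Fin d) :
    ((frameSection a n)⁻¹).1.mulVec (Pi.single r.castSucc 1) = Pi.single r.succ 1 := by
  have h : (frameSection a n).1.mulVec (Pi.single r.succ 1) = Pi.single r.castSucc 1 :=
    frameMatrix_mulVec_single_succ _ _
  rw [← h, Matrix.mulVec_mulVec, ← Matrix.SpecialLinearGroup.coe_mul, inv_mul_cancel,
    Matrix.SpecialLinearGroup.coe_one, Matrix.one_mulVec]

/-- The constant sequence of the first basis vector. -/
def cyclicVector (d N : ℕ) : VecSeq d N := fun _ => Pi.single 0 1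

/-- L(a)⁻¹ moves each basis vector but the last to its successor, so the powers of T up to Tᵐ⁻¹ turn
e₁ into the standard basis. -/
theorem opAction_mono_cyclicVector (a : Invariants d N) (j : Fin (d + 1)) (n : ZMod N) :
    opAction a (mono j 1) (cyclicVector d N) n = Pi.single j 1 := by
  induction j using Fin.induction generalizing n with
  | zero => rw [Fin.val_zero, Nat.cast_zero, mono_zero_one, map_one]; rfl
  | succ r ih =>
    rw [Fin.val_succ, Nat.cast_succ, opAction_mono_add_one, ← Fin.val_castSucc, ih,
      inv_frameSection_mulVec_castSucc]

/-- The action of the Lax operator in terms of the first column of `L(aₙ)`. -/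
theorem opAction_laxOp (a : Invariants d N) (w : VecSeq d N) (n : ZMod N) :
    (-1 : ℝ) ^ (d + 1) • opAction a (laxOp ((-1) ^ (d + 1)) a) w n =
      w n - ∑ j, frameMatrix (a n) j 0 • opAction a (mono (j + 1) 1) w n := by
  have h₁ : opAction a (laxOp ((-1) ^ (d + 1)) a) w n =
      opAction a (mono (d + 1) 1) w n + (-1 : ℝ) ^ (d + 1) • w n
        - ∑ r : Fin d, a n r • opAction a (mono (r + 1) 1) w n := by
    rw [laxOp, map_add, map_add]
    change _ + opAction a (-∑ r : Fin d, mono (r + 1) fun n => a n r) w n = _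
    rw [map_neg, map_sum, LinearMap.neg_apply, LinearMap.sum_apply, Pi.neg_apply, Finset.sum_apply,
      ← sub_eq_add_neg]
    congr 1
    · change _ + opAction a (mono 0 fun _ => (-1) ^ (d + 1)) w n = _
      rw [opAction_mono_apply a 0 fun _ => (-1) ^ (d + 1), mono_zero_one, map_one (opAction a)]
      rfl
    · exact Finset.sum_congr rfl fun r _ => opAction_mono_apply a _ _ w n
  have h₂ : ((-1 : ℝ) ^ (d + 1)) * (-1) ^ (d + 1) = 1 := neg_one_pow_mul_self _
  rw [h₁, Fin.sum_univ_castSucc, frameMatrix_last_zero, smul_sub, smul_add, smul_smul, h₂, one_smul,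
    Finset.smul_sum]
  simp only [frameMatrix_castSucc_zero, smul_smul, Fin.val_castSucc, Fin.val_last]
  rw [pow_succ]
  module

/-- Combining the vectors Tʲe₁, 1 ≤ j ≤ m, with the entries of the first column of L gives L⁻¹Le₁ =
e₁. The constant term e = (-1)ᵐ is what makes D record exactly this relation. -/
theorem opAction_laxOp_cyclicVector (a : Invariants d N) :
    opAction a (laxOp ((-1) ^ (d + 1)) a) (cyclicVector d N) = 0 := by
  funext n
  have h := opAction_laxOp a (cyclicVector d N) n
  have h₁ : ∑ j, frameMatrix (a n) j 0 • opAction a (mono (j + 1) 1) (cyclicVector d N) n =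
      ((frameSection a n)⁻¹).1.mulVec ((frameMatrix (a n)).mulVec (Pi.single 0 1)) := by
    rw [Matrix.mulVec_single_one, Matrix.mulVec_eq_sum]
    refine Finset.sum_congr rfl fun j _ => ?_
    rw [opAction_mono_add_one, opAction_mono_cyclicVector, Matrix.mulVec_single_one,
      op_smul_eq_smul]
    rfl
  have h₂ : (frameSection a n)⁻¹.1 * frameMatrix (a n) = 1 := by
    change (frameSection a n)⁻¹.1 * (frameSection a n).1 = 1
    rw [← Matrix.SpecialLinearGroup.coe_mul, inv_mul_cancel, Matrix.SpecialLinearGroup.coe_one]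
  rw [h₁, Matrix.mulVec_mulVec, h₂, Matrix.one_mulVec] at h
  have h₃ : (-1 : ℝ) ^ (d + 1) ≠ 0 := pow_ne_zero _ (by norm_num)
  refine (smul_eq_zero.1 (h.trans ?_)).resolve_left h₃
  exact sub_self _

theorem opAction_invariantsOp_cyclicVector (a v : Invariants d N) (n : ZMod N) :
    opAction a (invariantsOp v) (cyclicVector d N) n = Fin.cons 0 fun r => -v n r := by
  change opAction a (-∑ r : Fin d, mono (r + 1) fun n => v n r) _ n = _
  rw [map_neg, map_sum, LinearMap.neg_apply, LinearMap.sum_apply, Pi.neg_apply, Finset.sum_apply]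
  have h : ∀ r : Fin d, opAction a (mono (r + 1) fun n => v n r) (cyclicVector d N) n =
      v n r • Pi.single r.succ 1 := by
    intro r
    rw [opAction_mono_apply, ← opAction_mono_cyclicVector a r.succ n, Fin.val_succ, Nat.cast_succ]
  simp only [h]
  funext i
  refine Fin.cases ?_ (fun s => ?_) i
  · simp [Finset.sum_apply]
  · simp [Finset.sum_apply, Pi.single_apply]

theorem opAction_cyclicVector_apply (a : Invariants d N) {x : DiffOp N} (h₀ : ∀ k < 0, co k x = 0)
    (h₁ : ∀ k : ℤ, d < k → co k x = 0) (n : ZMod N) (i : Fin (d + 1)) :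
    opAction a x (cyclicVector d N) n i = co i x n := by
  have hx : x = ∑ j : Fin (d + 1), mono j (co j x) := by
    refine diffOp_ext fun k => ?_
    rw [map_sum]
    simp only [co_mono]
    by_cases hk : 0 ≤ k ∧ k ≤ d
    · lift k to ℕ using hk.1
      rw [Finset.sum_eq_single (⟨k, by omega⟩ : Fin (d + 1))]
      · simp
      · intro j _ hj
        rw [if_neg]
        rintro h
        exact hj (Fin.ext (by simpa using h.symm))
      · simp
    · have hz : co k x = 0 := by
        rcases lt_or_ge k 0 with h | h
        · exact h₀ k h
        · exact h₁ k (by omega)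
      rw [hz, Finset.sum_eq_zero]
      intro j _
      rw [if_neg]
      have := j.2
      omega
  conv_lhs => rw [hx]
  rw [map_sum, LinearMap.sum_apply, Finset.sum_apply]
  simp only [opAction_mono_apply a _ (co _ x), opAction_mono_cyclicVector]
  simp [Finset.sum_apply, Pi.single_apply]

end Representation

/-! ### The reduced brackets as Hamiltonian operators -/

section ReducedBrackets

variable {d N : ℕ}

theorem upperPart_snd_support (e : ℝ) (a : Invariants d N) (η : Invariants d N →L[ℝ] ℝ) :
    (∀ k < 0, co k (upperPart (d + 1) (laxOp e a) (covectorOp η)).2 = 0) ∧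
      (∀ k : ℤ, d < k → co k (upperPart (d + 1) (laxOp e a) (covectorOp η)).2 = 0) := by
  refine ⟨(upperPair_upperPart _ _ _).2.1, fun k hk => ?_⟩
  have h := (co_mul_of_ge (x := covectorOp η) (y := laxOp e a) (a := -1) (b := d + 1)
    (fun k hk => co_covectorOp_of_nonneg η (by omega)) (fun k hk => co_laxOp_of_gt e a hk)).1 k
    (by omega)
  rw [upperPart_apply, map_add, co_posPart, co_mono, h, if_neg (show k ≠ 0 by omega)]
  simp

theorem co_upperPart_snd (m : ℤ) (D Ξ : DiffOp N) {k : ℤ} (hk : 0 < k) :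
    co k (upperPart m D Ξ).2 = co k (Ξ * D) := by
  rw [upperPart_apply, map_add, co_posPart, co_mono, if_neg hk.ne', if_pos hk, add_zero]

/-- The matrices with columns `Tʲ X e₁`. -/
def krylovMatrix (a : Invariants d N) (X : DiffOp N) (n : ZMod N) :
    Matrix (Fin (d + 1)) (Fin (d + 1)) ℝ :=
  Matrix.of fun i j => opAction a (mono j 1) (opAction a X (cyclicVector d N)) n i

/-- Multiplying by L⁻¹ advances each column by one power of T, and right multiplication by L moves
the columns back, except that the first becomes a combination of all of them. The discrepancy there
is (-1)ᵐ D acting on X e₁. -/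
theorem krylovMatrix_sub (a : Invariants d N) (X : DiffOp N) (n : ZMod N) :
    krylovMatrix a X n
        - (frameSection a n)⁻¹.1 * (krylovMatrix a X (n + 1) * frameMatrix (a n)) =
      Matrix.of fun i j => if j = 0 then (-1) ^ (d + 1) *
        opAction a (laxOp ((-1) ^ (d + 1)) a * X) (cyclicVector d N) n i else 0 := by
  have hcol : ∀ i j, ((frameSection a n)⁻¹.1 * krylovMatrix a X (n + 1)) i j =
      opAction a (mono (j + 1) 1) (opAction a X (cyclicVector d N)) n i := by
    intro i j
    rw [opAction_mono_add_one]
    rfl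
  ext i j
  rw [← mul_assoc, Matrix.sub_apply]
  refine Fin.cases ?_ (fun r => ?_) j
  · have h := congrFun (opAction_laxOp a (opAction a X (cyclicVector d N)) n) i
    rw [Matrix.of_apply, if_pos rfl, map_mul]
    refine Eq.trans ?_ h.symm
    rw [Matrix.mul_apply, Pi.sub_apply, Finset.sum_apply]
    congr 1
    · change opAction a (mono ((0 : Fin (d + 1)) : ℕ) 1) _ n i = _
      rw [Fin.val_zero, Nat.cast_zero, mono_zero_one, map_one (opAction a)]
      rfl
    · refine Finset.sum_congr rfl fun k _ => ?_
      rw [hcol, mul_comm]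
      rfl
  · rw [mul_frameMatrix_succ, hcol, Matrix.of_apply, if_neg (Fin.succ_ne_zero r)]
    change opAction a (mono (r.succ : ℕ) 1) _ n i - _ = 0
    rw [Fin.val_succ, Nat.cast_succ, Fin.val_castSucc, sub_self]

theorem trace_mul_eq_sum_of_first_row {M Z : Matrix (Fin (d + 1)) (Fin (d + 1)) ℝ}
    (hM : ∀ i j, ¬(i = 0 ∧ j ≠ 0) → M i j = 0) :
    (Z * M).trace = ∑ r : Fin d, Z r.succ 0 * M 0 r.succ := by
  rw [Matrix.trace_mul_comm, Matrix.trace, Fin.sum_univ_succ, Finset.sum_eq_zero, add_zero,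
    Matrix.diag_apply, Matrix.mul_apply, Fin.sum_univ_succ, hM 0 0 (by simp), zero_mul, zero_add]
  · exact Finset.sum_congr rfl fun r _ => mul_comm _ _
  · intro i _
    rw [Matrix.diag_apply, Matrix.mul_apply]
    exact Finset.sum_eq_zero fun j _ => by rw [hM _ _ fun h => Fin.succ_ne_zero i h.1, zero_mul]

variable [NeZero N] {a : Invariants d N} {ξ η : Invariants d N →L[ℝ] ℝ}
  {Q P Q' P' : ZMod N → Matrix (Fin (d + 1)) (Fin (d + 1)) ℝ}

/-- Let Z be the Krylov matrix of X. Its first column below the corner is minus that of Q', as both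
come from the coefficients of ΞD. By `krylovMatrix_sub`, pairing Zₙ - L⁻¹Zₙ₊₁L with Qₙ tests DXe₁
against the first row of Qₙ, which carries ξ. As Pₙ - Qₙ₊₁ lies in the first row, only the known
part of Z survives the trace. -/
theorem IsGradientPair.apply_hamiltonian (hcop : Nat.Coprime N (d + 1))
    (h : IsGradientPair a ξ Q P) (h' : IsGradientPair a η Q' P') :
    ξ (hamiltonian ((-1) ^ (d + 1)) a η) =
      ∑ n, (Q' (n + 1) * (P n - Q (n + 1))).trace := by
  set D := laxOp ((-1) ^ (d + 1)) a with hD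
  set X := (upperPart (d + 1) D (covectorOp η)).2 with hX
  set Z := krylovMatrix a X with hZ
  set δ := hamiltonian ((-1) ^ (d + 1)) a η with hδ
  have hsupp := upperPart_snd_support ((-1) ^ (d + 1)) a η
  have hZ₀ : ∀ n (r : Fin d), Z n r.succ 0 = -Q' n r.succ 0 := by
    intro n r
    have h₁ : Z n r.succ 0 = co (r.succ : ℕ) X n := by
      rw [← opAction_cyclicVector_apply a hsupp.1 hsupp.2]
      change opAction a (mono ((0 : Fin (d + 1)) : ℕ) 1) _ n _ = _
      rw [Fin.val_zero, Nat.cast_zero, mono_zero_one, map_one (opAction a)]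
      rfl
    rw [h₁, Fin.val_succ, Nat.cast_succ, co_upperPart_snd _ _ _ (by omega), h'.first_column]
  have hDX : D * X = (upperPart (d + 1) D (covectorOp η)).1 * D - invariantsOp δ := by
    rw [hδ, invariantsOp_hamiltonian hcop, quadField, ← hD, sub_sub_cancel]
  -- Since D kills e₁, the term YD drops out and DXe₁ is the Hamiltonian vector itself.
  have hv : ∀ n, opAction a (D * X) (cyclicVector d N) n = Fin.cons 0 fun r => δ n r := by
    intro n
    rw [hDX, map_sub, map_mul, LinearMap.sub_apply, Module.End.mul_apply,
      opAction_laxOp_cyclicVector, map_zero, zero_sub, Pi.neg_apply,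
      opAction_invariantsOp_cyclicVector]
    funext i
    refine Fin.cases ?_ (fun r => ?_) i <;> simp
  have htr : ∀ n, ∑ r, ξ (Pi.single n (Pi.single r 1)) * δ n r =
      (Q n * Z n).trace - (P n * Z (n + 1)).trace := by
    intro n
    have h₁ : (P n * Z (n + 1)).trace =
        (Q n * ((frameSection a n)⁻¹.1 * (Z (n + 1) * frameMatrix (a n)))).trace := by
      have h₂ : frameMatrix (a n) * (frameSection a n)⁻¹.1 = 1 := by
        change (frameSection a n).1 * (frameSection a n)⁻¹.1 = 1
        rw [← Matrix.SpecialLinearGroup.coe_mul, mul_inv_cancel,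
          Matrix.SpecialLinearGroup.coe_one]
      rw [← mul_assoc, ← mul_assoc, Matrix.trace_mul_comm _ (frameMatrix (a n)), ← mul_assoc,
        ← mul_assoc, ← h.mul_eq, mul_assoc (P n), h₂, mul_one]
    rw [h₁, ← Matrix.trace_sub, ← mul_sub, krylovMatrix_sub, ← hD, Matrix.trace]
    refine Eq.trans ?_ (Fin.sum_univ_succ _).symm
    refine Eq.trans (add_zero _).symm (congrArg₂ _ ?_ (Finset.sum_eq_zero ?_).symm)
    · rw [Matrix.diag_apply, Matrix.mul_apply, Fin.sum_univ_succ]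
      simp only [Matrix.of_apply, if_true, hv, Fin.cons_zero, Fin.cons_succ, h.first_row, mul_zero,
        zero_add]
      refine Finset.sum_congr rfl fun r _ => ?_
      linear_combination -ξ (Pi.single n (Pi.single r 1)) * δ n r * neg_one_pow_mul_self (d + 1)
    · intro r _
      rw [Matrix.diag_apply, Matrix.mul_apply]
      refine Finset.sum_eq_zero fun k _ => ?_
      rw [Matrix.of_apply, if_neg (Fin.succ_ne_zero r), mul_zero]
  rw [covector_apply, Finset.sum_congr rfl fun n _ => htr n, Finset.sum_sub_distrib,
    ← Equiv.sum_comp (Equiv.addRight (1 : ZMod N)) fun n => (Q n * Z n).trace,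
    ← Finset.sum_sub_distrib]
  refine Finset.sum_congr rfl fun n _ => ?_
  have hM : ∀ i j, ¬(i = 0 ∧ j ≠ 0) → (P n - Q (n + 1)) i j = 0 := fun i j hij => by
    rw [Matrix.sub_apply, h.apply_eq n i j hij, sub_self]
  have h₃ := trace_mul_eq_sum_of_first_row (Z := Z (n + 1)) hM
  simp only [hZ₀, neg_mul, Finset.sum_neg_distrib] at h₃
  rw [← trace_mul_eq_sum_of_first_row (Z := Q' (n + 1)) hM, Matrix.trace_mul_comm, sub_mul,
    Matrix.trace_sub] at h₃
  rw [Equiv.coe_addRight]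
  linarith

/-- The first column of Q holds coefficients of ΞD and the first row of Q' holds η, so each half is
a trace of a triple product; cyclicity assembles the two into the commutator [D, Ξ]. -/
theorem companion_sum (h : IsGradientPair a ξ Q P) (h' : IsGradientPair a η Q' P') :
    ∑ n, (∑ r : Fin d, Q n r.succ 0 * Q' n 0 r.succ - ∑ r : Fin d, Q' n r.succ 0 * Q n 0 r.succ) =
      (-1) ^ (d + 1) * ξ (linearHamiltonian a η) := by
  have h₁ : ∀ {ξ η : Invariants d N →L[ℝ] ℝ} {Q P Q' P' : ZMod N → Matrix _ _ ℝ},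
      IsGradientPair a ξ Q P → IsGradientPair a η Q' P' →
      ∑ n, ∑ r : Fin d, Q n r.succ 0 * Q' n 0 r.succ =
        (-1) ^ (d + 1) * η (readInvariants (covectorOp ξ * laxOp 0 a)) := by
    intro ξ η Q P Q' P' h h'
    rw [covector_apply, Finset.mul_sum]
    refine Finset.sum_congr rfl fun n _ => ?_
    rw [Finset.mul_sum]
    refine Finset.sum_congr rfl fun r _ => ?_
    rw [readInvariants_apply, h.first_column, h'.first_row]
    ring
  have h₂ : ξ (readInvariants (laxOp 0 a * covectorOp η)) =
      η (readInvariants (covectorOp ξ * laxOp 0 a)) := by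
    rw [← neg_inj, ← opTrace_covectorOp_mul, ← opTrace_covectorOp_mul, ← mul_assoc,
      opTrace_mul_comm]
  rw [Finset.sum_sub_distrib, h₁ h h', h₁ h' h, linearHamiltonian_apply, map_sub, map_sub, h₂]
  ring

theorem companionBracket_eq (hcop : Nat.Coprime N (d + 1)) {f g : Invariants d N → ℝ}
    (hf : ContDiff ℝ ∞ f) (hg : ContDiff ℝ ∞ g) (a : Invariants d N) :
    companionBracket f g a =
      (-1) ^ (d + 1) / 2 * fderiv ℝ f a (linearHamiltonian a (fderiv ℝ g a)) := by
  have h := companion_sum (isGradientPair hcop hf a) (isGradientPair hcop hg a)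
  simp only [companionBracket, companionTensor, trace_gradeNegOne_mul_gradeOne]
  rw [h]
  ring

/-- After shifting the right-gradient sum by one index, `twisted_summand` applies with Pₙ and Qₙ₊₁.
It yields half the difference of the two orders of the Hamiltonian pairing, which equals the pairing
by skewness. -/
theorem reducedBracket_eq (hcop : Nat.Coprime N (d + 1)) {f g : Invariants d N → ℝ}
    (hf : ContDiff ℝ ∞ f) (hg : ContDiff ℝ ∞ g) (a : Invariants d N) :
    reducedBracket f g a = fderiv ℝ f a (hamiltonian ((-1) ^ (d + 1)) a (fderiv ℝ g a)) := by
  have h := isGradientPair hcop hf a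
  have h' := isGradientPair hcop hg a
  have h₁ := h.apply_hamiltonian hcop h'
  have h₂ := h'.apply_hamiltonian hcop h
  have h₃ := hamiltonian_skew hcop ((-1) ^ (d + 1)) a (fderiv ℝ f a) (fderiv ℝ g a)
  have hsum := Finset.sum_congr rfl fun s (_ : s ∈ Finset.univ) => twisted_summand
    (fun i j hij => h.apply_eq s i j hij) (fun i j hij => h'.apply_eq s i j hij)
  rw [← Finset.mul_sum, Finset.sum_sub_distrib, ← h₁, ← h₂] at hsum
  rw [reducedBracket, twistedBracket,
    ← Equiv.sum_comp (Equiv.addRight (1 : ZMod N)) fun s =>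
      rWedge (rightGradient (invariantExtension f) (frameSection a) s)
        (rightGradient (invariantExtension g) (frameSection a) s),
    ← Finset.sum_add_distrib, ← Finset.sum_sub_distrib, ← Finset.sum_add_distrib]
  refine hsum.trans ?_
  linarith

end ReducedBrackets

end TwistedPolygon

end

/-! ### The bi-Hamiltonian structure -/

theorem mainTheorem1 (d N : ℕ) [NeZero N] (hcop : Nat.Coprime N (d + 1)) :
    (IsOpen (TwistedPolygon.regularSet d N) ∧
      ∀ f : TwistedPolygon.Invariants d N → ℝ, ContDiff ℝ ∞ f →
        TwistedPolygon.IsInvariantExtension f (TwistedPolygon.invariantExtension f)) ∧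
    TwistedPolygon.IsPoissonBracket
      (fun f g : TwistedPolygon.Invariants d N → ℝ =>
        TwistedPolygon.reducedBracket f g + TwistedPolygon.companionBracket f g) ∧
    TwistedPolygon.AreCompatible
      (fun f g : TwistedPolygon.Invariants d N → ℝ => TwistedPolygon.reducedBracket f g)
      (fun f g : TwistedPolygon.Invariants d N → ℝ => TwistedPolygon.companionBracket f g) := by
  have key : ∀ s t : ℝ, TwistedPolygon.IsPoissonBracket
      (fun f g : TwistedPolygon.Invariants d N → ℝ =>
        s • TwistedPolygon.reducedBracket f g + t • TwistedPolygon.companionBracket f g) := by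
    intro s t
    refine TwistedPolygon.isPoissonBracket_pencil hcop s
      -- The coefficient of the linear bracket collects (-1)ᵐ from the reduced bracket, which is
      -- taken at e = (-1)ᵐ, and (-1)ᵐ/2 from the companion bracket.
      (s * (-1) ^ (d + 1) + t * ((-1) ^ (d + 1) / 2)) _ fun f g hf hg => ?_
    funext a
    rw [Pi.add_apply, Pi.smul_apply, Pi.smul_apply, TwistedPolygon.reducedBracket_eq hcop hf hg,
      TwistedPolygon.companionBracket_eq hcop hf hg, TwistedPolygon.hamiltonian_eq]
    simp only [Pi.add_apply, Pi.smul_apply, add_apply, smul_apply, map_add, map_smul, smul_eq_mul]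
    ring
  refine ⟨⟨TwistedPolygon.isOpen_regularSet hcop,
    fun f hf => TwistedPolygon.isInvariantExtension hcop hf⟩, ?_, ?_, ?_, key⟩
  · simpa only [one_smul] using key 1 1
  · simpa only [one_smul, zero_smul, add_zero] using key 1 0
  · simpa only [one_smul, zero_smul, zero_add] using key 0 1
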